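/- **Setting.** Let $d,N\ge 2$ be integers. For $n\in\mathbb N=\{0,1,2,\dots\}$ let $\mathcal Q_n$ be the set of the $N^{nd}$ closed grid cubes $\prod_{i=1}^d[l_iN^{-n},(l_i+1)N^{-n}]$, $0\le l_i<N^n$, in $[0,1]^d$, and for $A\subset\mathbb R^d$ let $\mathcal Q_n(A)=\{Q\in\mathcal Q_n: Q\subset A\}$. Let $\Omega=\{0,1\}^{\bigsqcup_n\mathcal Q_n}$ (the cubes are the vertices of the $N^d$-branching tree), with the product measure $\mathbb P_p$ of the measures $(1-p)\delta_0+p\delta_1$. A cube $Q$ is *chosen* if $\omega(Q)=1$ and *deleted* if $\omega(Q)=0$. Let $\Pi_i$ be the $i$-th coordinate projection and $\mathcal H^1$ the 1-dimensional Hausdorff measure. An *$(n,i)$-layer* is a set $\Pi_i^{-1}([kN^{-n},(k+1)N^{-n}])$ with $0\le k<N^n$. For $Q,Q'\in\mathcal Q_n$ write $Q\sim Q'$ if $Q\cap Q'\neq\emptyset$, and $Q\sim_iQ'$ if moreover $Q$ and $Q'$ lie in a common $(n,i)$-layer. Put $k_Q=\bigcup_{Q'\sim Q}Q'$ and $K_Q=\bigcup_{Q'\sim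 Q}k_{Q'}$. For $x\in[0,1]^d$ let $Q_n(x)\in\mathcal Q_n$ be the cube whose half-open counterpart contains $x$; the half-open intervals are $[lN^{-n},(l+1)N^{-n})$, the last of which is closed at $1$. **Good cubes.** A direction $i$ is a *principle direction* of a line $\ell$ if $|x_j-y_j|\le|x_i-y_i|$ for all $x,y\in\ell$ and all $j$. The line $\ell$ *intersects* $Q\in\mathcal Q_n$ *properly* if $\mathcal H^1(\Pi_i(\ell\cap Q))\ge d^{-1}N^{-n}$ for a principle direction $i$ of $\ell$. Let $m_0\ge1$. A cube $Q'$ is *strongly $i$-deleted* if every $\widetilde Q\sim_iQ'$ is deleted. A cube $Q\in\mathcal Q_n$ is *$m_0$-good for $\ell$* if for every principle direction $i$ of $\ell$ the following holds: if $\mathcal L_1,\dots,\mathcal L_k$ are, in their natural order, the $(n+m_0,i)$-layers with $\mathcal H^1(\ell\cap Q\cap\mathcal L_j)>0$, then there is a strongly $i$-deleted $Q'\in\mathcal Q_{n+m_0}(Q)$ which $\ell$ intersects properly and which is contained in none of $\mathcal L_1,\mathcal L_2,\mathcal L_{k-1},\mathcal L_k$. Let $\Gamma(Q,m_0)$ be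 the set of all lines through a vertex $v$ of $Q$ and a point of $N^{-n-m_0}\mathbb Z^d\cap F$, where $F$ is a $(d-1)$-dimensional face of $Q$ not containing $v$. The cube $Q$ is *$m_0$-good* if it is $m_0$-good for all lines that intersect $Q$ properly and are parallel to a line of $\Gamma(Q,m_0)$. **Goodness along a sequence.** Let $\mathbf L=(L_0>L_1>\dots>L_k=0)$ be integers and $\mathfrak c\ge1$. If $k=0$, a cube is *$(\mathbf L,\mathfrak c,m_0)$-good* if it is $m_0$-good. If $k\ge1$, $Q\in\mathcal Q_n$ is *$(\mathbf L,\mathfrak c,m_0)$-good* if at most $\mathfrak c$ cubes of $\mathcal Q_{n+L_{k-1}}(Q)$ fail to be $(\widetilde{\mathbf L},\mathfrak c,m_0)$-good, where $\widetilde{\mathbf L}=(L_j-L_{k-1})_{j=0}^{k-1}$. **The sequences $\mathbf L^i$.** Let $m_1\ge1$, $k_0\ge2$ and $l_0=m_1(1+2+\dots+k_0)$. Put $L^0_j=l_0-m_1(0+1+\dots+j)$ for $0\le j\le k_0$. Let $i\ge1$ and suppose that $\mathbf L^{i-1}=(L^{i-1}_j)_{j=0}^{k_{i-1}}$ is given.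 * If $m_1k_{i-1}<l_0$, put $L^i_j=l_0+L^{i-1}_j$ for $j\le k_{i-1}$. For $j=k_{i-1}+1,k_{i-1}+2,\dots$ let $L^i_j$ be the largest member of $\mathbf L^{i-1}$ that is at most $L^i_{j-1}-m_1j$, provided that it exists and is at least $m_1(j+1)$. Otherwise put $k_i=j$, $L^i_{j}=0$, and stop. * If $m_1k_{i-1}\ge l_0$, let $i_0<i$ be the index with $m_1k_{i_0}=l_0$. Put $L^i_j=l_0+L^{i-1}_j$ for $0\le j<l_0/m_1$, and for $j=l_0/m_1+t-1$, $1\le t\le r$, put $L^i_j=L^i_{j-1}-h_tl_0$, where $(h_1,\dots,h_r)=H_{i-i_0}$; the last value is $0$ and $k_i=l_0/m_1+r-1$. Here the finite sequences $H_0,H_1,\dots$ of powers of two are defined by $H_0=(1)$, $e_0=0$ and, for $c\ge0$, $H_{c+1}=(H_{c+1-2^{e}},2^{e})$ (the sequence $H_{c+1-2^e}$ with $2^e$ appended), where $e=e_{c+1}$ is equal to $e_c$ if $H_{c+1-2^{e_c}}$ has at most $2(e_c+1)$ terms, and to $e_c+1$ otherwise. A cube is *$(q,m_1,k_0,\mathfrak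 c,m_0)$-hereditarily good* if it is $(\mathbf L^l(m_1,k_0),\mathfrak c,m_0)$-good for all $l=0,\dots,q$. **Proposition.** Let $0\le p<1$, let $m_1\ge1$ and $\mathfrak c=4^d+1$. There is a positive integer $m_0=m_0(m_1,p,d,N)$, not depending on $k_0$, such that for every integer $k_0\ge2$ and for $\mathbb P_p$-almost every $\omega\in\Omega$, $$\dim_{\mathrm H}\Bigl\{x\in[0,1]^d : \#\bigl\{n\in\mathbb N : \text{every }Q'\in\mathcal Q_n(K_{Q_n(x)})\text{ is }(q,m_1,k_0,\mathfrak c,m_0)\text{-hereditarily good}\bigr\}<\infty\Bigr\}<1\qquad\text{for all }q\in\mathbb N .$$ -/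

import Mathlib

open MeasureTheory Set
open scoped ENNReal Affine

namespace FractalPercolation

noncomputable section

/-! ### Grid cubes and the probability space -/

/-- The ambient Euclidean space `ℝ^d`. -/
abbrev Space (d : ℕ) : Type := EuclideanSpace ℝ (Fin d)

/-- The side length `N^{-n}` of the grid cubes of level `n`. -/
def side (N n : ℕ) : ℝ := ((N : ℝ) ^ n)⁻¹

/-- The (names of the) grid cubes of level `n` in `[0,1]^d`, of which there are `N^{nd}`. The cube
with `corner = l` is `∏ i, [l i * N^{-n}, (l i + 1) * N^{-n}]`, see `GridCube.toSet`. -/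
structure GridCube (N d n : ℕ) where
  /-- the coordinates of the lower corner, in units of `N^{-n}` -/
  corner : Fin d → Fin (N ^ n)

/-- The closed cube itself, as a subset of `ℝ^d`. -/
def GridCube.toSet {N d n : ℕ} (Q : GridCube N d n) : Set (Space d) :=
  {x | ∀ i, ((Q.corner i : ℕ) : ℝ) * side N n ≤ x i ∧
    x i ≤ (((Q.corner i : ℕ) : ℝ) + 1) * side N n}

/-- The vertices of the rooted `N^d`-branching tree. A vertex at distance `n` from the root is a
grid cube of level `n`, and its `N^d` children are the cubes of level `n + 1` inside it. -/
abbrev Vertex (N d : ℕ) : Type := Σ n : ℕ, GridCube N d n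

/-- The space `{0,1}^{v(T)}`; `ω ⟨n, Q⟩ = true` means that the cube `Q` is chosen, and
`ω ⟨n, Q⟩ = false` that it is deleted. -/
abbrev Config (N d : ℕ) : Type := Vertex N d → Bool

/-- The product measure `((1 - p) δ_0 + p δ_1)^{v(T)}`. -/
def percolationMeasure (N d : ℕ) (p : unitInterval) : Measure (Config N d) :=
  Measure.infinitePi fun _ : Vertex N d => ProbabilityTheory.bernoulliMeasure true false p

/-! ### Layers, neighbours, lines -/

/-- The `(n, i)`-layer `Π_i⁻¹ [k N^{-n}, (k + 1) N^{-n}]`, where `k ∈ {0, …, N^n - 1}`. -/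
def layer {d : ℕ} (N n : ℕ) (i : Fin d) (k : Fin (N ^ n)) : Set (Space d) :=
  {x | ((k : ℕ) : ℝ) * side N n ≤ x i ∧ x i ≤ (((k : ℕ) : ℝ) + 1) * side N n}

/-- `Q ∼ Q'`: the two cubes (of the same level) intersect. -/
def GridCube.Neighbour {N d n : ℕ} (Q Q' : GridCube N d n) : Prop :=
  (Q.toSet ∩ Q'.toSet).Nonempty

/-- `Q ∼_i Q'`: neighbours that lie in a common `(n, i)`-layer. -/
def GridCube.LayerNeighbour {N d n : ℕ} (i : Fin d) (Q Q' : GridCube N d n) : Prop :=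
  Q.Neighbour Q' ∧ ∃ k : Fin (N ^ n), Q.toSet ⊆ layer N n i k ∧ Q'.toSet ⊆ layer N n i k

/-- The union `k_Q` of all neighbours of `Q`. -/
def GridCube.nbhd {N d n : ℕ} (Q : GridCube N d n) : Set (Space d) :=
  ⋃ (Q' : GridCube N d n) (_ : Q.Neighbour Q'), Q'.toSet

/-- The union `K_Q` of the sets `k_{Q'}` over all neighbours `Q'` of `Q`. -/
def GridCube.bigNbhd {N d n : ℕ} (Q : GridCube N d n) : Set (Space d) :=
  ⋃ (Q' : GridCube N d n) (_ : Q.Neighbour Q'), Q'.nbhd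

/-- A straight line in `ℝ^d`. -/
def IsLine {d : ℕ} (ℓ : AffineSubspace ℝ (Space d)) : Prop :=
  Module.finrank ℝ ℓ.direction = 1

/-- `i` is a principle direction for `ℓ`: for every subsegment `[x, y]` of `ℓ`, the length
`|x j - y j|` of its projection to the `j`-th coordinate axis is maximal for `j = i`. -/
def IsPrincipleDirection {d : ℕ} (ℓ : AffineSubspace ℝ (Space d)) (i : Fin d) : Prop :=
  ∀ x ∈ ℓ, ∀ y ∈ ℓ, ∀ j : Fin d, |x j - y j| ≤ |x i - y i|

/-- The line `ℓ` intersects the cube `Q` properly: `ℋ¹(Π_i (ℓ ∩ Q)) ≥ d⁻¹ N^{-n}` for a principle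
direction `i` of `ℓ`. (All principle directions give the same value.) -/
def IntersectsProperly {N d n : ℕ} (ℓ : AffineSubspace ℝ (Space d)) (Q : GridCube N d n) : Prop :=
  ∃ i : Fin d, IsPrincipleDirection ℓ i ∧
    ENNReal.ofReal ((d : ℝ)⁻¹ * side N n) ≤
      Measure.hausdorffMeasure (1 : ℝ) ((fun x : Space d => x i) '' ((ℓ : Set (Space d)) ∩ Q.toSet))

/-! ### Good cubes -/

/-- `Q` is strongly `i`-deleted: every cube `Q'` with `Q' ∼_i Q` (so also `Q` itself) is deleted. -/
def StronglyDeleted {N d m : ℕ} (ω : Config N d) (i : Fin d) (Q : GridCube N d m) : Prop :=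
  ∀ Q' : GridCube N d m, Q'.LayerNeighbour i Q → ω ⟨m, Q'⟩ = false

/-- The indices of the `(n + m₀, i)`-layers that meet `ℓ ∩ Q` in a set of positive length. -/
def crossedLayers {N d n : ℕ} (m₀ : ℕ) (Q : GridCube N d n) (ℓ : AffineSubspace ℝ (Space d))
    (i : Fin d) : Set (Fin (N ^ (n + m₀))) :=
  {k | 0 < Measure.hausdorffMeasure (1 : ℝ)
    ((ℓ : Set (Space d)) ∩ Q.toSet ∩ layer N (n + m₀) i k)}

/-- `k` is one of the first two or of the last two elements of `J`. -/
def IsExtremal {M : ℕ} (J : Set (Fin M)) (k : Fin M) : Prop :=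
  k ∈ J ∧ ({j ∈ J | j < k}.ncard < 2 ∨ {j ∈ J | k < j}.ncard < 2)

/-- `Q` is `m₀`-good for the line `ℓ` with principle direction `i`: there is a strongly `i`-deleted
cube `Q'` of level `n + m₀` in `Q` that `ℓ` intersects properly and that lies in none of the first
two and the last two of the `(n + m₀, i)`-layers that `ℓ ∩ Q` crosses. -/
def GoodForLineDir {N d n : ℕ} (ω : Config N d) (m₀ : ℕ) (Q : GridCube N d n)
    (ℓ : AffineSubspace ℝ (Space d)) (i : Fin d) : Prop :=
  ∃ Q' : GridCube N d (n + m₀), Q'.toSet ⊆ Q.toSet ∧ StronglyDeleted ω i Q' ∧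
    (∀ k, IsExtremal (crossedLayers m₀ Q ℓ i) k → ¬ Q'.toSet ⊆ layer N (n + m₀) i k) ∧
    IntersectsProperly ℓ Q'

/-- `Q` is `m₀`-good for the line `ℓ`. If the principle direction of `ℓ` is not unique, the
condition is required for each of them. -/
def GoodForLine {N d n : ℕ} (ω : Config N d) (m₀ : ℕ) (Q : GridCube N d n)
    (ℓ : AffineSubspace ℝ (Space d)) : Prop :=
  ∀ i : Fin d, IsPrincipleDirection ℓ i → GoodForLineDir ω m₀ Q ℓ i

/-- The `(d-1)`-dimensional face of `Q` perpendicular to the `i`-th axis, the lower one for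
`b = 0` and the upper one for `b = 1`. -/
def GridCube.face {N d n : ℕ} (Q : GridCube N d n) (i : Fin d) (b : Fin 2) : Set (Space d) :=
  {x ∈ Q.toSet | x i = (((Q.corner i : ℕ) : ℝ) + ((b : ℕ) : ℝ)) * side N n}

/-- The set of the `2^d` vertices of `Q`. -/
def GridCube.vertices {N d n : ℕ} (Q : GridCube N d n) : Set (Space d) :=
  {x | ∀ i, x i = ((Q.corner i : ℕ) : ℝ) * side N n ∨
    x i = (((Q.corner i : ℕ) : ℝ) + 1) * side N n}

/-- The points of the natural grid of side length `N^{-m}` in `ℝ^d`. -/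
def gridPoints (N d m : ℕ) : Set (Space d) :=
  {x | ∀ i, ∃ z : ℤ, x i = (z : ℝ) * side N m}

/-- The collection `Γ(Q, m₀)` of the lines through a vertex `v` of `Q` and a point of the grid of
side length `N^{-n-m₀}` in a `(d-1)`-dimensional face of `Q` that does not contain `v`. -/
def lineFamily {N d n : ℕ} (Q : GridCube N d n) (m₀ : ℕ) : Set (AffineSubspace ℝ (Space d)) :=
  {ℓ | IsLine ℓ ∧ ∃ (i : Fin d) (b : Fin 2), ∃ v ∈ Q.vertices, v ∉ Q.face i b ∧ v ∈ ℓ ∧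
    ∃ g ∈ Q.face i b ∩ gridPoints N d (n + m₀), g ∈ ℓ}

/-- `Q` is `m₀`-good: it is `m₀`-good for all lines that intersect `Q` properly and are parallel to
a line of `Γ(Q, m₀)`. -/
def IsGood {N d n : ℕ} (ω : Config N d) (m₀ : ℕ) (Q : GridCube N d n) : Prop :=
  ∀ ℓ : AffineSubspace ℝ (Space d), IsLine ℓ → IntersectsProperly ℓ Q →
    (∃ ℓ' ∈ lineFamily Q m₀, ℓ ∥ ℓ') → GoodForLine ω m₀ Q ℓ

/-- `Q` is `(k, L, c, m₀)`-good, for a finite sequence `L 0 > L 1 > … > L k = 0`. For `k = 0` this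
means `m₀`-good. For `k + 1` it means that at most `c` of the cubes of level `n + L k` in `Q` are
`(k, L, c, m₀)`-bad, and for these cubes the sequence is `L 0 - L k > … > L k - L k = 0`.
Only the values `L 0, …, L k` matter. -/
def SeqGood {N d : ℕ} (ω : Config N d) (c m₀ : ℕ) :
    (k : ℕ) → (L : ℕ → ℕ) → (n : ℕ) → GridCube N d n → Prop
  | 0, _, _, Q => IsGood ω m₀ Q
  | k + 1, L, n, Q =>
      {Q' : GridCube N d (n + L k) | Q'.toSet ⊆ Q.toSet ∧
        ¬ SeqGood ω c m₀ k (fun j => L j - L k) (n + L k) Q'}.ncard ≤ c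

/-! ### The level sequences

A finite sequence `L 0 > L 1 > … > L k = 0` is coded by a function `L : ℕ → ℕ` that vanishes from
`k` on; `k` is recovered as `lastIndex L`. -/

/-- The index `k` of the final element `L k = 0` of the sequence. -/
def lastIndex (L : ℕ → ℕ) : ℕ := sInf {j | L j = 0}

/-- `1 + 2 + ⋯ + k₀`, which is `l₀ / m₁`. -/
def triangle (k₀ : ℕ) : ℕ := ∑ t ∈ Finset.range (k₀ + 1), t

/-- `l₀ = m₁ (1 + 2 + ⋯ + k₀)`. -/
def blockLength (m₁ k₀ : ℕ) : ℕ := m₁ * triangle k₀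

/-- `L⁰`, with `L⁰ j = l₀ - m₁ (0 + 1 + ⋯ + j)` for `j ≤ k₀`; the value at `k₀` is `0`. -/
def initialSeq (m₁ k₀ : ℕ) (j : ℕ) : ℕ := blockLength m₁ k₀ - m₁ * triangle j

/-- The greatest member of the sequence `P` that is at most `a - b`, or `0` if there is none. -/
def roundDown (P : ℕ → ℕ) (a b : ℕ) : ℕ :=
  ((Finset.range (lastIndex P + 1)).filter fun l => P l + b ≤ a).sup P

/-- The first case of the inductive step, from the sequence `P` to the next sequence `L`:
`L j = l₀ + P j` up to the last index of `P`; after that `L j` is the greatest member of `P` that is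
at most `L (j - 1) - m₁ j` provided that this number is at least `m₁ (j + 1)`, and otherwise
`L j = 0` is the final element. -/
def roundUpStep (m₁ k₀ : ℕ) (P : ℕ → ℕ) : ℕ → ℕ
  | 0 => blockLength m₁ k₀ + P 0
  | j + 1 =>
      if j + 1 ≤ lastIndex P then blockLength m₁ k₀ + P (j + 1)
      else if m₁ * (j + 2) ≤ roundDown P (roundUpStep m₁ k₀ P j) (m₁ * (j + 1)) then
        roundDown P (roundUpStep m₁ k₀ P j) (m₁ * (j + 1))
      else 0

/-- The construction of the columns of blocks. A column is the list of the heights of its blocks,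
in units of `l₀` and from the lowest block (with which the column begins) to the topmost one.
`columnsAux c` is the pair of the number `e` such that the topmost block of column `c` has height
`2^e`, and of a table that is correct for all columns up to `c`. Column `0` is one block of
height `1`. Column `c + 1` is the column `2^e` steps before it, translated along the diagonal, with
one block of height `2^e` on top, if this gives at most `2 (e + 1) + 1` blocks; otherwise `e` is
replaced by `e + 1`. -/
def columnsAux : ℕ → ℕ × (ℕ → List ℕ)
  | 0 => (0, fun _ => [1])
  | c + 1 =>
      let e := (columnsAux c).1
      let T := (columnsAux c).2
      let e' := if (T (c + 1 - 2 ^ e)).length + 1 ≤ 2 * (e + 1) + 1 then e else e + 1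
      (e', Function.update T (c + 1) (T (c + 1 - 2 ^ e') ++ [2 ^ e']))

/-- The block heights of column `c` (which is column `i₀ + c` when the columns are numbered like the
sequences), from the lowest block up, in units of `l₀`. -/
def column (c : ℕ) : List ℕ := (columnsAux c).2 c

/-- The second case of the inductive step, from the sequence `P` to the next sequence `L`:
`L j = l₀ + P j` for `j < l₀ / m₁`; after that the steps `L (j - 1) - L j` are the heights of the
blocks of the column `col`, from the lowest to the topmost block. -/
def blockStep (m₁ k₀ : ℕ) (col : List ℕ) (P : ℕ → ℕ) : ℕ → ℕ
  | 0 => blockLength m₁ k₀ + P 0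
  | j + 1 =>
      if j + 1 < triangle k₀ then blockLength m₁ k₀ + P (j + 1)
      else blockStep m₁ k₀ col P j - blockLength m₁ k₀ * col.getD (j + 1 - triangle k₀) 0

/-- The sequence `Lⁱ`, together with the number of steps so far that fell into the second case.
If `i₀` is the index with `m₁ k_{i₀} = l₀`, the latter is `i - i₀` for `i ≥ i₀`. -/
def levelSeqAux (m₁ k₀ : ℕ) : ℕ → (ℕ → ℕ) × ℕ
  | 0 => (initialSeq m₁ k₀, 0)
  | i + 1 =>
      let P := (levelSeqAux m₁ k₀ i).1
      let c := (levelSeqAux m₁ k₀ i).2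
      if m₁ * lastIndex P < blockLength m₁ k₀ then (roundUpStep m₁ k₀ P, 0)
      else (blockStep m₁ k₀ (column (c + 1)) P, c + 1)

/-- The sequence `Lⁱ(m₁, k₀)`. -/
def levelSeq (m₁ k₀ i : ℕ) : ℕ → ℕ := (levelSeqAux m₁ k₀ i).1

/-! ### Hereditarily good cubes and the exceptional set -/

/-- `Q` is `(q, m₁, k₀, c, m₀)`-hereditarily good: it is `(Lˡ(m₁, k₀), c, m₀)`-good for all
`l = 0, …, q`. -/
def HereditarilyGood {N d n : ℕ} (ω : Config N d) (q m₁ k₀ c m₀ : ℕ) (Q : GridCube N d n) : Prop :=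
  ∀ l ≤ q, SeqGood ω c m₀ (lastIndex (levelSeq m₁ k₀ l)) (levelSeq m₁ k₀ l) n Q

/-- `Q` is the cube `Q_n(x)` of level `n` whose half-open counterpart contains `x ∈ [0,1]^d`. The
half-open intervals are `[l N^{-n}, (l + 1) N^{-n})`, except that the last one, `l = N^n - 1`, also
contains its right end point `1`. -/
def IsCubeOf {N d n : ℕ} (x : Space d) (Q : GridCube N d n) : Prop :=
  ∀ i, ((Q.corner i : ℕ) : ℝ) * side N n ≤ x i ∧
    (x i < (((Q.corner i : ℕ) : ℝ) + 1) * side N n ∨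
      ((Q.corner i : ℕ) + 1 = N ^ n ∧ x i = 1))

/-- The set of the points `x ∈ [0,1]^d` for which there are only finitely many `n` such that all
cubes of level `n` in `K_{Q_n(x)}` are `(q, m₁, k₀, c, m₀)`-hereditarily good. -/
def exceptionalSet {N d : ℕ} (ω : Config N d) (q m₁ k₀ c m₀ : ℕ) : Set (Space d) :=
  {x | (∀ i, x i ∈ Set.Icc (0 : ℝ) 1) ∧
    {n : ℕ | ∃ Q : GridCube N d n, IsCubeOf x Q ∧
      ∀ Q' : GridCube N d n, Q'.toSet ⊆ Q.bigNbhd →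
        HereditarilyGood ω q m₁ k₀ c m₀ Q'}.Finite}

end

end FractalPercolation

/-! Almost surely the exceptional set is empty for every `q`, so its dimension is `0`. The reason is
a first moment estimate: along the nested cubes around an exceptional point, badness recurs at every
level from some level on, and the expected number of such chains of cubes tends to zero.

One cube. Put `K = N ^ m`. A line that meets `Q` properly crosses more than `K / (2d)` of the fine
layers, and over each unit layer it stays in a single column of cubes for a fraction `1/d` of the
time (`exists_column_of_line`). Rounding position and slope replaces the lines by polynomially many
(in `K`) integer paths. Along one path the blocks of at most `13 ^ d` cubes in `r`, about `K /
(4d)`, different layers are independent, and each is entirely deleted with probability at least `(1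
- p) ^ 13 ^ d`. Hence `Q` is bad with probability at most a polynomial in `K` times `ρ ^ r`, with `ρ
< 1`, which for suitable `m` is at most `N ^ (-(d m + C))` (`exists_measure_not_isGood_le`).

Sequences. More than `4 ^ d + 1` bad subcubes include five with the same corner parities, and these
five are independent. Each step of the sequence therefore raises the probability of badness to the
fifth power, at the price of choosing five subcubes. This price is affordable if the steps grow at
most like `m₁ 4 ^ (j + 1)`, since `5 > 4`; the badness probability then also beats the number of all
descendants down to the depth that the event depends on (`measure_not_seqGood_le`). All sequences
`Lⁱ` have this growth (`levelSeq_admissible`), with a bound that involves `m₁` but not `k₀`, so `m₀`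
does not depend on `k₀`.

Chains. Badness near `Q` depends on one finer level; the next cube of the chain starts below that
level, so consecutive links are independent. The number of choices of the next cube times the
probability of a link is at most `2 ^ (-(l + 2))` for the `l`-th sequence, so chains of length `j`
exist with probability at most `2 ^ (-j)` for every `q` (`measure_badChain_le`). An exceptional
point would produce chains of all lengths from some cube, and there are only countably many triples
of `q`, level and cube. -/

namespace FractalPercolation

noncomputable section

/-! ### Columns of blocks -/

/-- The exponent of the topmost block of a column. -/
def topExp (c : ℕ) : ℕ := (columnsAux c).1

lemma columnsAux_table (c b : ℕ) (h : b ≤ c) : (columnsAux c).2 b = column b := by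
  induction c with
  | zero => obtain rfl : b = 0 := by omega
            rfl
  | succ c ih =>
    rcases Nat.lt_or_ge c b with hb | hb
    · obtain rfl : b = c + 1 := by omega
      rfl
    · rw [← ih hb]
      simp only [columnsAux]
      rw [Function.update_of_ne (by omega)]

lemma topExp_succ (c : ℕ) : topExp (c + 1) =
    if (column (c + 1 - 2 ^ topExp c)).length + 1 ≤ 2 * (topExp c + 1) + 1 then topExp c
    else topExp c + 1 := by
  have : c + 1 - 2 ^ topExp c ≤ c := by have := Nat.one_le_two_pow (n := topExp c); omega
  rw [← columnsAux_table c _ this]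
  rfl

lemma column_succ (c : ℕ) :
    column (c + 1) = column (c + 1 - 2 ^ topExp (c + 1)) ++ [2 ^ topExp (c + 1)] := by
  have : c + 1 - 2 ^ topExp (c + 1) ≤ c := by
    have := Nat.one_le_two_pow (n := topExp (c + 1)); omega
  rw [← columnsAux_table c _ this]
  show (columnsAux (c + 1)).2 (c + 1) = _
  have h : topExp (c + 1) = (columnsAux (c + 1)).1 := rfl
  rw [h]
  simp only [columnsAux]
  rw [Function.update_self]

lemma column_of_pos {c : ℕ} (h : 1 ≤ c) :
    column c = column (c - 2 ^ topExp c) ++ [2 ^ topExp c] := by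
  obtain ⟨c, rfl⟩ := Nat.exists_eq_add_of_le' h
  exact column_succ c

lemma topExp_mono : Monotone topExp := by
  refine monotone_nat_of_le_succ fun c => ?_
  rw [topExp_succ]
  split_ifs <;> omega

lemma column_zero : column 0 = [1] := rfl

lemma topExp_zero : topExp 0 = 0 := rfl

/-- The bound `2 ^ topExp c ≤ c` says that the truncated subtraction in the construction is genuine.
The last clause, that taking off the top block lowers the exponent by at most one, is what bounds
the block heights; the length bound is needed to propagate it. -/
lemma column_invariant (c : ℕ) : (column c).length ≤ 2 * topExp c + 3 ∧
    (1 ≤ c → 2 ^ topExp c ≤ c ∧ topExp c ≤ topExp (c - 2 ^ topExp c) + 1) := by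
  induction c using Nat.strong_induction_on with
  | _ c ih =>
  rcases c with _ | c
  · simp [column_zero]
  have hlen : (column (c + 1)).length = (column (c + 1 - 2 ^ topExp (c + 1))).length + 1 := by
    rw [column_succ]; simp
  have hp := Nat.one_le_two_pow (n := topExp c)
  have hs := topExp_succ c
  split_ifs at hs with hif
  · rw [hs] at hlen ⊢
    refine ⟨by omega, fun _ => ?_⟩
    rcases Nat.eq_zero_or_pos c with rfl | hc
    · simp [topExp_zero]
    · obtain ⟨-, h⟩ := ih c (by omega)
      obtain ⟨h1, h2⟩ := h hc
      refine ⟨by omega, h2.trans ?_⟩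
      gcongr
      exact topExp_mono (by omega)
  -- Column `b` was too long for another block of height `2 ^ e`, where `e = topExp c`. Its length
  -- bound forces its exponent to be `e`, so the new block `2 ^ (e + 1)` reaches down to column `b`
  -- without its top block, which is still long enough to have exponent `e`.
  · set b := c + 1 - 2 ^ topExp c with hb
    obtain ⟨u, v⟩ := ih b (by omega)
    have hbe : topExp b ≤ topExp c := topExp_mono (by omega)
    have hbe' : topExp b = topExp c := by omega
    have hb1 : 1 ≤ b := by
      rcases Nat.eq_zero_or_pos b with h0 | h0
      · rw [h0, column_zero] at hif
        simp at hif
      · exact h0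
    obtain ⟨v1, v2⟩ := v hb1
    rw [hbe'] at v1 v2
    have hlb : (column b).length = (column (b - 2 ^ topExp c)).length + 1 := by
      rw [column_of_pos hb1, hbe']; simp
    have hpow : 2 ^ topExp (c + 1) = 2 ^ topExp c + 2 ^ topExp c := by rw [hs, pow_succ]; ring
    have hbb : c + 1 - 2 ^ topExp (c + 1) = b - 2 ^ topExp c := by omega
    have u' := (ih (b - 2 ^ topExp c) (by omega)).1
    rw [hbb] at hlen ⊢
    have hm : topExp (b - 2 ^ topExp c) ≤ topExp c := topExp_mono (by omega)
    refine ⟨by omega, fun _ => ⟨by omega, by omega⟩⟩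

lemma topExp_lt_length (c : ℕ) : topExp c < (column c).length := by
  rcases c with _ | c
  · simp [topExp_zero, column_zero]
  · induction c using Nat.strong_induction_on with
    | _ c ih =>
    obtain ⟨h1, h2⟩ := (column_invariant (c + 1)).2 (by omega)
    rw [column_succ, List.length_append, List.length_singleton]
    have hp := Nat.one_le_two_pow (n := topExp (c + 1))
    rcases hb : c + 1 - 2 ^ topExp (c + 1) with _ | b
    · rw [hb, topExp_zero] at h2
      rw [column_zero]
      simp only [List.length_singleton]
      omega
    · have := ih b (by omega)
      rw [hb] at h2
      omega

/-- The block at position `t` is the top block of a column of length `t + 1`, and the exponent of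
the top block is less than the length. -/
lemma column_getD_le (c t : ℕ) : (column c).getD t 0 ≤ 2 ^ t := by
  induction c using Nat.strong_induction_on with
  | _ c ih =>
  rcases c with _ | c
  · rcases t with _ | t <;> simp [column_zero]
  have hp := Nat.one_le_two_pow (n := topExp (c + 1))
  have hlt := topExp_lt_length (c + 1)
  have hi := ih (c + 1 - 2 ^ topExp (c + 1)) (by omega)
  rw [column_succ] at hlt ⊢
  rw [List.length_append, List.length_singleton] at hlt
  rcases lt_trichotomy t (column (c + 1 - 2 ^ topExp (c + 1))).length with h | h | h
  · rwa [List.getD_append _ _ _ _ h]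
  · rw [List.getD_append_right _ _ _ _ h.ge, h]
    simpa using Nat.pow_le_pow_right two_pos (by omega)
  · rw [List.getD_eq_default _ _ (by simp; omega)]
    exact Nat.zero_le _

/-- This total height brings the sequences of the second case down to `0`. -/
lemma column_sum (c : ℕ) : (column c).sum = c + 1 := by
  induction c using Nat.strong_induction_on with
  | _ c ih =>
  rcases c with _ | c
  · simp [column_zero]
  have hp := Nat.one_le_two_pow (n := topExp (c + 1))
  obtain ⟨h1, -⟩ := (column_invariant (c + 1)).2 (by omega)
  rw [column_succ, List.sum_append, ih _ (by omega), List.sum_singleton]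
  omega

/-! ### The level sequences -/

lemma triangle_zero : triangle 0 = 0 := by simp [triangle]

lemma triangle_succ (j : ℕ) : triangle (j + 1) = triangle j + (j + 1) :=
  Finset.sum_range_succ _ _

lemma triangle_mono : Monotone triangle :=
  monotone_nat_of_le_succ fun j => by rw [triangle_succ]; omega

lemma succ_le_triangle {k : ℕ} (hk : 2 ≤ k) : k + 1 ≤ triangle k := by
  induction k, hk using Nat.le_induction with
  | base => decide
  | succ k hk ih => rw [triangle_succ]; omega

lemma apply_lastIndex {L : ℕ → ℕ} (h : ∃ j, L j = 0) : L (lastIndex L) = 0 :=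
  Nat.sInf_mem (s := {j | L j = 0}) h

lemma lastIndex_le {L : ℕ → ℕ} {j : ℕ} (h : L j = 0) : lastIndex L ≤ j :=
  Nat.sInf_le (s := {j | L j = 0}) h

/-- Nonincreasing sequences with steps `L j - L (j + 1) ≤ m₁ 4 ^ (j + 1)`. -/
structure Admissible (m₁ : ℕ) (L : ℕ → ℕ) : Prop where
  succ_le : ∀ j, L (j + 1) ≤ L j
  gap : ∀ j, L j ≤ L (j + 1) + m₁ * 4 ^ (j + 1)

lemma Admissible.antitone {m₁ : ℕ} {L : ℕ → ℕ} (h : Admissible m₁ L) : Antitone L :=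
  antitone_nat_of_succ_le h.succ_le

/-- Geometric sum of the gaps. The whole depth is thus of the order of the last permitted step, and
the final probability bound can pay for it. -/
lemma Admissible.zero_le {m₁ : ℕ} {L : ℕ → ℕ} (h : Admissible m₁ L) (k : ℕ) :
    L 0 ≤ L k + 2 * m₁ * 4 ^ k := by
  induction k with
  | zero => omega
  | succ k ih =>
    have h1 := h.gap k
    have h2 : 0 ≤ m₁ * 4 ^ k := Nat.zero_le _
    rw [pow_succ] at *
    linarith

lemma le_roundDown {P : ℕ → ℕ} {a b l : ℕ} (hl : l ≤ lastIndex P) (h : P l + b ≤ a) :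
    P l ≤ roundDown P a b :=
  Finset.le_sup (f := P) (by simp; omega)

lemma roundDown_le (P : ℕ → ℕ) (a b : ℕ) : roundDown P a b ≤ a - b :=
  Finset.sup_le fun l hl => by simp only [Finset.mem_filter] at hl; omega

/-- The invariant of the construction of the level sequences. -/
structure LevelInvariant (m₁ k₀ : ℕ) (P : ℕ → ℕ) (c : ℕ) : Prop extends Admissible m₁ P where
  exists_zero : ∃ j, P j = 0
  block_le : blockLength m₁ k₀ ≤ P 0
  cases : (lastIndex P < triangle k₀ ∧ c = 0) ∨
    (triangle k₀ ≤ lastIndex P ∧ P (triangle k₀ - 1) ≤ (c + 1) * blockLength m₁ k₀)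

lemma levelInvariant_initial {m₁ k₀ : ℕ} (hk : 2 ≤ k₀) :
    LevelInvariant m₁ k₀ (initialSeq m₁ k₀) 0 where
  succ_le j := by
    unfold initialSeq
    have := Nat.mul_le_mul_left m₁ (triangle_mono (Nat.le_succ j))
    simp only [Nat.succ_eq_add_one] at this
    omega
  gap j := by
    unfold initialSeq
    have h : j + 1 < 4 ^ (j + 1) := Nat.lt_pow_self (by norm_num)
    have := Nat.mul_le_mul_left m₁ h.le
    rw [triangle_succ, Nat.mul_add]
    omega
  exists_zero := ⟨k₀, by simp [initialSeq, blockLength]⟩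
  block_le := by simp [initialSeq, triangle_zero]
  cases := by
    left
    refine ⟨?_, rfl⟩
    have h : initialSeq m₁ k₀ k₀ = 0 := by simp [initialSeq, blockLength]
    have := lastIndex_le h
    have := succ_le_triangle hk
    omega

lemma roundUpStep_of_le {m₁ k₀ : ℕ} {P : ℕ → ℕ} {j : ℕ} (h : j ≤ lastIndex P) :
    roundUpStep m₁ k₀ P j = blockLength m₁ k₀ + P j := by
  rcases j with _ | j
  · rfl
  · rw [roundUpStep, if_pos h]

/-- Past the last index `K` of `P` the values are at most `l₀ ≤ P 0`, so the target `L j - m₁ (j +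
1)`, if nonnegative, lies within the range of `P`. Rounding down to a member of `P` costs at most
the largest gap `m₁ 4 ^ K ≤ m₁ 4 ^ j`, and replacing a small value by the final `0` costs at most
`m₁ (j + 2)`. -/
lemma levelInvariant_roundUp {m₁ k₀ : ℕ} (hm : 1 ≤ m₁) {P : ℕ → ℕ} {c : ℕ}
    (hP : LevelInvariant m₁ k₀ P c) (hlt : lastIndex P < triangle k₀) :
    LevelInvariant m₁ k₀ (roundUpStep m₁ k₀ P) 0 := by
  set L := roundUpStep m₁ k₀ P with hL
  set K := lastIndex P with hK
  have hPK : P K = 0 := apply_lastIndex hP.exists_zero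
  have hstep : ∀ j, K ≤ j →
      (L (j + 1) = roundDown P (L j) (m₁ * (j + 1)) ∨ L (j + 1) = 0) ∧
        (roundDown P (L j) (m₁ * (j + 1)) ≤ L (j + 1) + m₁ * (j + 2)) := by
    intro j hj
    rw [hL, roundUpStep, if_neg (by omega)]
    split_ifs with h
    · exact ⟨Or.inl rfl, by omega⟩
    · exact ⟨Or.inr rfl, by omega⟩
  have hsucc : ∀ j, L (j + 1) ≤ L j := by
    intro j
    rcases Nat.lt_or_ge j K with hj | hj
    · rw [hL, roundUpStep_of_le (show j + 1 ≤ K from hj), roundUpStep_of_le hj.le]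
      have := hP.succ_le j
      omega
    · have := roundDown_le P (L j) (m₁ * (j + 1))
      rcases (hstep j hj).1 with h | h <;> omega
  have hanti : Antitone L := antitone_nat_of_succ_le hsucc
  have hLK : L K = blockLength m₁ k₀ := by rw [hL, roundUpStep_of_le le_rfl, hPK, add_zero]
  have hzero : ∃ j, L j = 0 := by
    have key : ∀ t, L (K + t) ≤ L K - t := by
      intro t
      induction t with
      | zero => simp
      | succ t ih =>
        have h1 := roundDown_le P (L (K + t)) (m₁ * (K + t + 1))
        have h2 : 1 ≤ m₁ * (K + t + 1) := Nat.mul_pos hm (by omega)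
        have h3 := (hstep (K + t) (by omega)).1
        rw [← add_assoc]
        omega
    exact ⟨K + L K, by have := key (L K); omega⟩
  refine ⟨⟨hsucc, ?_⟩, hzero, ?_, ?_⟩
  · intro j
    rcases Nat.lt_or_ge j K with hj | hj
    · rw [hL, roundUpStep_of_le (show j + 1 ≤ K from hj), roundUpStep_of_le hj.le]
      have := hP.gap j
      omega
    · have h1 := (hstep j hj).2
      set a := L j with ha
      have ha0 : a ≤ P 0 := (hanti hj).trans (hLK.le.trans hP.block_le)
      set b := m₁ * (j + 1) with hb
      have hb1 : 1 ≤ b := Nat.mul_pos hm (by omega)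
      have h2 : a ≤ b + roundDown P a b + m₁ * 4 ^ K := by
        by_contra! hcon
        have hex : ∃ s, P s + b ≤ a := ⟨K, by omega⟩
        have hs := Nat.find_spec hex
        have hsK : Nat.find hex ≤ K := Nat.find_min' hex (by omega)
        rcases hs0 : Nat.find hex with _ | s
        · rw [hs0] at hs; omega
        · rw [hs0] at hs hsK
          have h3 : ¬ (P s + b ≤ a) := Nat.find_min hex (by omega)
          have h4 := hP.gap s
          have h5 := le_roundDown (P := P) hsK hs
          have h6 : m₁ * 4 ^ (s + 1) ≤ m₁ * 4 ^ K :=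
            Nat.mul_le_mul_left _ (Nat.pow_le_pow_right (by norm_num) hsK)
          omega
      have h3 : m₁ * 4 ^ K ≤ m₁ * 4 ^ j :=
        Nat.mul_le_mul_left _ (Nat.pow_le_pow_right (by norm_num) hj)
      have h4 : (j + 1) + (j + 2) + 4 ^ j ≤ 4 ^ (j + 1) := by
        clear * -
        induction j with
        | zero => norm_num
        | succ j ih => rw [pow_succ] at *; omega
      have h5 := Nat.mul_le_mul_left m₁ h4
      rw [Nat.mul_add, Nat.mul_add] at h5
      omega
  · show _ ≤ blockLength m₁ k₀ + P 0
    omega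
  · rcases Nat.lt_or_ge (lastIndex L) (triangle k₀) with h | h
    · exact Or.inl ⟨h, rfl⟩
    · refine Or.inr ⟨h, ?_⟩
      rw [zero_add, one_mul, ← hLK]
      exact hanti (by omega)

lemma blockStep_of_lt {m₁ k₀ : ℕ} {col : List ℕ} {P : ℕ → ℕ} {j : ℕ} (h : j < triangle k₀) :
    blockStep m₁ k₀ col P j = blockLength m₁ k₀ + P j := by
  rcases j with _ | j
  · rfl
  · rw [blockStep, if_pos h]

lemma blockStep_add {m₁ k₀ : ℕ} {col : List ℕ} {P : ℕ → ℕ} {T : ℕ} (hT : triangle k₀ = T + 1)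
    (t : ℕ) : blockStep m₁ k₀ col P (T + t) =
      blockStep m₁ k₀ col P T - blockLength m₁ k₀ * (col.take t).sum := by
  induction t with
  | zero => simp
  | succ t ih =>
    rw [← add_assoc, blockStep, if_neg (by omega), ih, Nat.sub_sub, ← Nat.mul_add]
    congr 2
    rw [show T + t + 1 - triangle k₀ = t by omega, List.take_add_one, List.sum_append]
    rcases h : col[t]? with _ | x <;> simp [h, List.getD_eq_getElem?_getD]

/-- With `T = triangle k₀`, a block step at index `j + 1` is at most `m₁ T 2 ^ (j + 1 - T)`, and `T
≤ 4 ^ T` absorbs the block length. The sequence ends in `0` because the blocks have total height `(c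
+ 2) l₀`, at least the value from which they descend; truncated subtraction makes this inequality
sufficient. -/
lemma levelInvariant_block {m₁ k₀ : ℕ} (hm : 1 ≤ m₁) (hk : 2 ≤ k₀) {P : ℕ → ℕ} {c : ℕ}
    (hP : LevelInvariant m₁ k₀ P c) (hge : triangle k₀ ≤ lastIndex P) :
    LevelInvariant m₁ k₀ (blockStep m₁ k₀ (column (c + 1)) P) (c + 1) := by
  set L := blockStep m₁ k₀ (column (c + 1)) P with hL
  have hT3 := succ_le_triangle hk
  obtain ⟨T, hT⟩ : ∃ T, triangle k₀ = T + 1 := ⟨triangle k₀ - 1, by omega⟩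
  have hl0 : 1 ≤ blockLength m₁ k₀ := Nat.mul_pos hm (by omega)
  have hPT : P T ≤ (c + 1) * blockLength m₁ k₀ := by
    rcases hP.cases with h | h
    · omega
    · have := h.2; rwa [show triangle k₀ - 1 = T by omega] at this
  have hLT : L T ≤ (c + 2) * blockLength m₁ k₀ := by
    rw [hL, blockStep_of_lt (by omega)]; linarith
  have hsucc : ∀ j, L (j + 1) ≤ L j := by
    intro j
    rcases Nat.lt_or_ge (j + 1) (triangle k₀) with hj | hj
    · rw [hL, blockStep_of_lt hj, blockStep_of_lt (by omega)]
      have := hP.succ_le j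
      omega
    · rw [hL, blockStep, if_neg (by omega)]; omega
  have hzero : ∃ j, L j = 0 := by
    refine ⟨T + (column (c + 1)).length, ?_⟩
    rw [hL, blockStep_add hT, ← hL, List.take_length, column_sum]
    rw [Nat.sub_eq_zero_iff_le]
    linarith
  refine ⟨⟨hsucc, ?_⟩, hzero, ?_, Or.inr ⟨?_, ?_⟩⟩
  · intro j
    rcases Nat.lt_or_ge (j + 1) (triangle k₀) with hj | hj
    · rw [hL, blockStep_of_lt hj, blockStep_of_lt (by omega)]
      have := hP.gap j
      omega
    · have h1 : L (j + 1) =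
          L j - blockLength m₁ k₀ * (column (c + 1)).getD (j + 1 - triangle k₀) 0 := by
        rw [hL, blockStep, if_neg (by omega)]
      have h2 : blockLength m₁ k₀ * (column (c + 1)).getD (j + 1 - triangle k₀) 0 ≤
          m₁ * 4 ^ (j + 1) := by
        rw [blockLength, mul_assoc]
        apply Nat.mul_le_mul_left
        calc triangle k₀ * (column (c + 1)).getD (j + 1 - triangle k₀) 0
            ≤ 4 ^ triangle k₀ * 4 ^ (j + 1 - triangle k₀) := by
              gcongr
              · exact (Nat.lt_pow_self (by norm_num)).le
              · exact (column_getD_le _ _).trans (Nat.pow_le_pow_left (by norm_num) _)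
          _ = 4 ^ (j + 1) := by rw [← pow_add]; congr 1; omega
      omega
  · show _ ≤ blockLength m₁ k₀ + P 0
    omega
  · by_contra! h
    have h1 := apply_lastIndex hzero
    rw [hL, blockStep_of_lt h] at h1
    omega
  · rw [show triangle k₀ - 1 = T by omega]
    exact hLT

lemma levelInvariant_levelSeqAux {m₁ k₀ : ℕ} (hm : 1 ≤ m₁) (hk : 2 ≤ k₀) (i : ℕ) :
    LevelInvariant m₁ k₀ (levelSeqAux m₁ k₀ i).1 (levelSeqAux m₁ k₀ i).2 := by
  induction i with
  | zero => exact levelInvariant_initial hk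
  | succ i ih =>
    rw [levelSeqAux]
    split_ifs with h
    · exact levelInvariant_roundUp hm ih (lt_of_mul_lt_mul_left h (Nat.zero_le _))
    · exact levelInvariant_block hm hk ih (le_of_mul_le_mul_left (not_lt.1 h) hm)

lemma levelSeq_admissible {m₁ k₀ : ℕ} (hm : 1 ≤ m₁) (hk : 2 ≤ k₀) (i : ℕ) :
    Admissible m₁ (levelSeq m₁ k₀ i) :=
  (levelInvariant_levelSeqAux hm hk i).toAdmissible

lemma levelSeq_lastIndex {m₁ k₀ : ℕ} (hm : 1 ≤ m₁) (hk : 2 ≤ k₀) (i : ℕ) :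
    levelSeq m₁ k₀ i (lastIndex (levelSeq m₁ k₀ i)) = 0 :=
  apply_lastIndex (levelInvariant_levelSeqAux hm hk i).exists_zero

/-- This growth makes the contributions of the different sequences summable, with a bound
independent of `q`. -/
lemma lt_levelSeq_zero {m₁ k₀ : ℕ} (hm : 1 ≤ m₁) (hk : 2 ≤ k₀) (i : ℕ) :
    i < levelSeq m₁ k₀ i 0 := by
  have hl0 : 1 ≤ blockLength m₁ k₀ :=
    Nat.mul_pos hm (by have := succ_le_triangle hk; omega)
  induction i with
  | zero => exact lt_of_lt_of_le hl0 (levelInvariant_levelSeqAux hm hk 0).block_le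
  | succ i ih =>
    have : levelSeq m₁ k₀ (i + 1) 0 = blockLength m₁ k₀ + levelSeq m₁ k₀ i 0 := by
      rw [levelSeq, levelSeqAux]
      split_ifs <;> rfl
    omega

/-! ### Geometry of the grid cubes -/

lemma side_pos {N : ℕ} (hN : 2 ≤ N) (n : ℕ) : 0 < side N n := by
  unfold side
  have : (0 : ℝ) < N := by exact_mod_cast (by omega : 0 < N)
  positivity

lemma side_eq_mul {N : ℕ} (hN : 2 ≤ N) (n m : ℕ) :
    side N n = ((N ^ m : ℕ) : ℝ) * side N (n + m) := by
  unfold side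
  have : (0 : ℝ) < N := by exact_mod_cast (by omega : 0 < N)
  push_cast
  rw [pow_add]
  field_simp

lemma pow_mul_side {N : ℕ} (hN : 2 ≤ N) (n : ℕ) : ((N ^ n : ℕ) : ℝ) * side N n = 1 := by
  unfold side
  have : (0 : ℝ) < N := by exact_mod_cast (by omega : 0 < N)
  push_cast
  field_simp

instance {N d n : ℕ} : Finite (GridCube N d n) :=
  Finite.of_injective GridCube.corner fun Q Q' h => by cases Q; cases Q'; simp_all

instance {N d n : ℕ} : Fintype (GridCube N d n) := Fintype.ofFinite _

open Classical in
lemma card_filter_le {N d n : ℕ} (P : GridCube N d n → Prop) (A : Fin d → Finset ℤ) (a : ℕ)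
    (h : ∀ Q, P Q → ∀ i, ((Q.corner i : ℕ) : ℤ) ∈ A i) (hA : ∀ i, (A i).card ≤ a) :
    (Finset.univ.filter P).card ≤ a ^ d := by
  calc (Finset.univ.filter P).card ≤ (Fintype.piFinset A).card := by
        refine Finset.card_le_card_of_injOn (fun Q i => ((Q.corner i : ℕ) : ℤ)) ?_ ?_
        · intro Q hQ
          simp only [Finset.coe_filter, Finset.mem_univ, true_and, Set.mem_ofPred_eq] at hQ
          simpa using h Q hQ
        · rintro ⟨Q⟩ - ⟨Q'⟩ - hQ
          congr 1
          funext i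
          have := congrFun hQ i
          simp only [Nat.cast_inj] at this
          exact Fin.ext this
    _ = ∏ i, (A i).card := Fintype.card_piFinset _
    _ ≤ ∏ _i : Fin d, a := Finset.prod_le_prod' fun i _ => hA i
    _ = a ^ d := by simp

/-- The point of a cube with given relative coordinates. -/
def GridCube.point {N d n : ℕ} (Q : GridCube N d n) (t : ℝ) : Space d :=
  WithLp.toLp 2 fun i => (((Q.corner i : ℕ) : ℝ) + t) * side N n

lemma GridCube.point_mem {N d n : ℕ} (hN : 2 ≤ N) (Q : GridCube N d n) {t : ℝ} (h0 : 0 ≤ t)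
    (h1 : t ≤ 1) : Q.point t ∈ Q.toSet := by
  intro i
  have := side_pos hN n
  simp only [GridCube.point]
  constructor <;> gcongr
  linarith

lemma GridCube.subset_iff {N d n m : ℕ} (hN : 2 ≤ N) (Q : GridCube N d n)
    (Q' : GridCube N d (n + m)) : Q'.toSet ⊆ Q.toSet ↔
      ∀ i, (Q.corner i : ℕ) * N ^ m ≤ (Q'.corner i : ℕ) ∧
        (Q'.corner i : ℕ) + 1 ≤ ((Q.corner i : ℕ) + 1) * N ^ m := by
  have hs := side_pos hN (n + m)
  have key : ∀ a : ℝ, a * side N n = (a * ((N ^ m : ℕ) : ℝ)) * side N (n + m) := fun a => by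
    rw [side_eq_mul hN n m]; ring
  constructor
  · intro h i
    have h0 := (h (Q'.point_mem hN le_rfl zero_le_one) i).1
    have h1 := (h (Q'.point_mem hN zero_le_one le_rfl) i).2
    simp only [GridCube.point] at h0 h1
    rw [key] at h0 h1
    replace h0 := le_of_mul_le_mul_right h0 hs
    replace h1 := le_of_mul_le_mul_right h1 hs
    rw [add_zero] at h0
    constructor
    · exact_mod_cast h0
    · exact_mod_cast h1
  · intro h x hx i
    obtain ⟨h0, h1⟩ := h i
    have h0' : ((Q.corner i : ℕ) : ℝ) * ((N ^ m : ℕ) : ℝ) ≤ ((Q'.corner i : ℕ) : ℝ) := by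
      exact_mod_cast h0
    have h1' : ((Q'.corner i : ℕ) : ℝ) + 1 ≤ (((Q.corner i : ℕ) : ℝ) + 1) * ((N ^ m : ℕ) : ℝ) := by
      exact_mod_cast h1
    rw [key, key]
    exact ⟨(mul_le_mul_of_nonneg_right h0' hs.le).trans (hx i).1,
      (hx i).2.trans (mul_le_mul_of_nonneg_right h1' hs.le)⟩

/-- Bounds for the corner of a cube that meets a larger grid cube. -/
lemma GridCube.corner_of_meets {N d n m : ℕ} (hN : 2 ≤ N) (Q : GridCube N d n)
    (Q' : GridCube N d (n + m)) (h : (Q'.toSet ∩ Q.toSet).Nonempty) (i : Fin d) :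
      (Q.corner i : ℕ) * N ^ m ≤ (Q'.corner i : ℕ) + 1 ∧
        (Q'.corner i : ℕ) ≤ ((Q.corner i : ℕ) + 1) * N ^ m := by
  have hs := side_pos hN (n + m)
  have key : ∀ a : ℝ, a * side N n = (a * ((N ^ m : ℕ) : ℝ)) * side N (n + m) := fun a => by
    rw [side_eq_mul hN n m]; ring
  obtain ⟨x, hx', hx⟩ := h
  have h0 := (hx i).1.trans (hx' i).2
  have h1 := (hx' i).1.trans (hx i).2
  rw [key] at h0 h1
  replace h0 := le_of_mul_le_mul_right h0 hs
  replace h1 := le_of_mul_le_mul_right h1 hs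
  constructor
  · exact_mod_cast h0
  · exact_mod_cast h1

lemma GridCube.Neighbour.corner_le {N d n : ℕ} (hN : 2 ≤ N) {Q Q' : GridCube N d n}
    (h : Q.Neighbour Q') (i : Fin d) :
    (Q.corner i : ℕ) ≤ (Q'.corner i : ℕ) + 1 ∧ (Q'.corner i : ℕ) ≤ (Q.corner i : ℕ) + 1 := by
  have := GridCube.corner_of_meets (m := 0) hN Q' Q h i
  simp only [pow_zero, mul_one] at this
  exact ⟨this.2, this.1⟩

lemma GridCube.corner_of_subset_bigNbhd {N d n : ℕ} (hN : 2 ≤ N) {Q Q' : GridCube N d n}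
    (h : Q'.toSet ⊆ Q.bigNbhd) (i : Fin d) :
    (Q.corner i : ℕ) ≤ (Q'.corner i : ℕ) + 2 ∧ (Q'.corner i : ℕ) ≤ (Q.corner i : ℕ) + 2 := by
  have hs := side_pos hN n
  have hx := h (Q'.point_mem hN (t := 1 / 2) (by norm_num) (by norm_num))
  simp only [GridCube.bigNbhd, GridCube.nbhd, Set.mem_iUnion] at hx
  obtain ⟨Q₁, h1, Q₂, h2, hx⟩ := hx
  have h1 := h1.corner_le hN i
  have h2 := h2.corner_le hN i
  obtain ⟨ha, hb⟩ := hx i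
  simp only [GridCube.point] at ha hb
  replace ha := le_of_mul_le_mul_right ha hs
  replace hb := le_of_mul_le_mul_right hb hs
  have ha' : ((Q₂.corner i : ℕ) : ℝ) < ((Q'.corner i : ℕ) : ℝ) + 1 := by linarith
  have hb' : ((Q'.corner i : ℕ) : ℝ) < ((Q₂.corner i : ℕ) : ℝ) + 1 := by linarith
  have ha'' : (Q₂.corner i : ℕ) < (Q'.corner i : ℕ) + 1 := by exact_mod_cast ha'
  have hb'' : (Q'.corner i : ℕ) < (Q₂.corner i : ℕ) + 1 := by exact_mod_cast hb'
  omega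

open Classical in
lemma card_subset_bigNbhd_le {N d n : ℕ} (hN : 2 ≤ N) (Q : GridCube N d n) :
    (Finset.univ.filter fun Q' : GridCube N d n => Q'.toSet ⊆ Q.bigNbhd).card ≤ 5 ^ d := by
  refine card_filter_le _ (fun i => Finset.Icc ((Q.corner i : ℕ) - 2 : ℤ) ((Q.corner i : ℕ) + 2)) 5
    (fun Q' h i => ?_) fun i => ?_
  · have := GridCube.corner_of_subset_bigNbhd hN h i
    rw [Finset.mem_Icc]
    omega
  · rw [Int.card_Icc]; omega

open Classical in
lemma card_subcubes_le {N d n m : ℕ} (hN : 2 ≤ N) (Q : GridCube N d n) :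
    (Finset.univ.filter fun Q' : GridCube N d (n + m) => Q'.toSet ⊆ Q.toSet).card ≤
      (N ^ m) ^ d := by
  refine card_filter_le _ (fun i => Finset.Ico (((Q.corner i : ℕ) * N ^ m : ℕ) : ℤ)
    ((((Q.corner i : ℕ) + 1) * N ^ m : ℕ) : ℤ)) (N ^ m) (fun Q' h i => ?_) fun i => ?_
  · have := (GridCube.subset_iff hN Q Q').1 h i
    rw [Finset.mem_Ico]
    omega
  · rw [Int.card_Ico, add_mul]
    push_cast
    rw [add_sub_cancel_left, one_mul]
    exact_mod_cast le_rfl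

lemma exists_isCubeOf {N d : ℕ} (hN : 2 ≤ N) (n : ℕ) {x : Space d}
    (hx : ∀ i, x i ∈ Set.Icc (0 : ℝ) 1) : ∃ Q : GridCube N d n, IsCubeOf x Q := by
  have hs := side_pos hN n
  have hNn : 0 < N ^ n := by positivity
  have h1 := pow_mul_side hN n
  have key : ∀ i, ∃ a : Fin (N ^ n), ((a : ℕ) : ℝ) * side N n ≤ x i ∧
    (x i < (((a : ℕ) : ℝ) + 1) * side N n ∨ ((a : ℕ) + 1 = N ^ n ∧ x i = 1)) := by
    intro i
    rcases (hx i).2.eq_or_lt with h | h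
    · refine ⟨⟨N ^ n - 1, by omega⟩, ?_, Or.inr ⟨by simp only; omega, h⟩⟩
      rw [h, ← h1]
      gcongr
      omega
    · have hlt : ⌊x i * ((N ^ n : ℕ) : ℝ)⌋₊ < N ^ n := by
        rw [Nat.floor_lt (mul_nonneg (hx i).1 (Nat.cast_nonneg _))]
        exact mul_lt_of_lt_one_left (by exact_mod_cast hNn) h
      have hx1 : x i * ((N ^ n : ℕ) : ℝ) * side N n = x i := by rw [mul_assoc, h1, mul_one]
      refine ⟨⟨_, hlt⟩, ?_, Or.inl ?_⟩
      · conv_rhs => rw [← hx1]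
        gcongr
        exact Nat.floor_le (mul_nonneg (hx i).1 (Nat.cast_nonneg _))
      · conv_lhs => rw [← hx1]
        gcongr
        exact Nat.lt_floor_add_one _
  choose a ha using key
  exact ⟨⟨a⟩, ha⟩

lemma IsCubeOf.subset {N d n m : ℕ} (hN : 2 ≤ N) {x : Space d} {Q : GridCube N d n}
    {Q' : GridCube N d (n + m)} (h : IsCubeOf x Q) (h' : IsCubeOf x Q') :
    Q'.toSet ⊆ Q.toSet := by
  have hs := side_pos hN (n + m)
  have key : ∀ a : ℝ, a * side N n = (a * ((N ^ m : ℕ) : ℝ)) * side N (n + m) := fun a => by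
    rw [side_eq_mul hN n m]; ring
  rw [GridCube.subset_iff hN]
  intro i
  have hK : 0 < N ^ m := by positivity
  obtain ⟨h0, h1⟩ := h i
  obtain ⟨h0', h1'⟩ := h' i
  have hQ := (Q.corner i).2
  have hQ' := (Q'.corner i).2
  have hpow : N ^ (n + m) = N ^ n * N ^ m := pow_add _ _ _
  constructor
  · rcases h1' with h1' | ⟨h1', -⟩
    · have := h0.trans_lt h1'
      rw [key] at this
      have := lt_of_mul_lt_mul_right this hs.le
      have : (Q.corner i : ℕ) * N ^ m < (Q'.corner i : ℕ) + 1 := by exact_mod_cast this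
      omega
    · have : ((Q.corner i : ℕ) + 1) * N ^ m ≤ N ^ n * N ^ m := Nat.mul_le_mul_right _ hQ
      rw [add_mul] at this
      omega
  · rcases h1 with h1 | ⟨h1, -⟩
    · have := h0'.trans_lt h1
      rw [key] at this
      have := lt_of_mul_lt_mul_right this hs.le
      have : (Q'.corner i : ℕ) < ((Q.corner i : ℕ) + 1) * N ^ m := by exact_mod_cast this
      omega
    · rw [h1]; omega

/-! ### Shadows -/

/-- The cubes of level `M` that meet `Q`. -/
def shadow {N d n : ℕ} (M : ℕ) (Q : GridCube N d n) : Set (Vertex N d) :=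
  {v | v.1 = M ∧ (v.2.toSet ∩ Q.toSet).Nonempty}

lemma shadow_mono {N d n n' M : ℕ} {Q : GridCube N d n} {Q' : GridCube N d n'}
    (h : Q'.toSet ⊆ Q.toSet) : shadow M Q' ⊆ shadow M Q :=
  fun _ hv => ⟨hv.1, hv.2.mono (Set.inter_subset_inter_right _ h)⟩

lemma finite_level (N d M : ℕ) : {v : Vertex N d | v.1 = M}.Finite := by
  refine (Set.finite_range fun Q : GridCube N d M => (⟨M, Q⟩ : Vertex N d)).subset ?_
  rintro ⟨n, Q⟩ rfl
  exact ⟨Q, rfl⟩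

lemma finite_shadow {N d n : ℕ} (M : ℕ) (Q : GridCube N d n) : (shadow M Q).Finite :=
  (finite_level N d M).subset fun _ hv => hv.1

/-- The parity class of a cube. -/
def GridCube.parity {N d n : ℕ} (Q : GridCube N d n) (i : Fin d) : Fin 2 :=
  ⟨(Q.corner i : ℕ) % 2, Nat.mod_lt _ two_pos⟩

/-- Distinct cubes of equal parity are separated in some coordinate by at least one full side, which
a cube of a finer level, of at most half that side, cannot bridge. -/
lemma disjoint_shadow {N d n M : ℕ} (hN : 2 ≤ N) (hM : n < M) {Q Q' : GridCube N d n}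
    (hne : Q ≠ Q') (hp : Q.parity = Q'.parity) : Disjoint (shadow M Q) (shadow M Q') := by
  rw [Set.disjoint_left]
  rintro ⟨M, R⟩ ⟨rfl, h⟩ ⟨-, h'⟩
  obtain ⟨m, rfl⟩ := Nat.exists_eq_add_of_lt hM
  rw [add_assoc] at R
  apply hne
  cases Q with | mk c =>
  cases Q' with | mk c' =>
  congr 1
  funext i
  have h1 := GridCube.corner_of_meets (m := m + 1) hN _ _ h i
  have h2 := GridCube.corner_of_meets (m := m + 1) hN _ _ h' i
  have h3 : (c i : ℕ) % 2 = (c' i : ℕ) % 2 := congrArg Fin.val (congrFun hp i)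
  have hK : 2 ≤ N ^ (m + 1) := hN.trans (Nat.le_self_pow (by omega) N)
  simp only at h1 h2
  have key : ∀ a b r K : ℕ, 2 ≤ K → a % 2 = b % 2 → a * K ≤ r + 1 → r ≤ (b + 1) * K → a ≤ b := by
    intro a b r K hK hab h1 h2
    by_contra! hlt
    have : (b + 2) * K ≤ a * K := Nat.mul_le_mul_right _ (by omega)
    rw [add_mul] at *
    omega
  exact Fin.ext (le_antisymm (key _ _ _ _ hK h3 h1.1 h2.2) (key _ _ _ _ hK h3.symm h2.1 h1.2))

/-! ### Events that depend on given cubes -/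

/-- The σ-algebra generated by the states of the cubes in `S`. -/
@[reducible]
def sigmaOn {N d : ℕ} (S : Set (Vertex N d)) : MeasurableSpace (Config N d) :=
  ⨆ v ∈ S, MeasurableSpace.comap (fun ω : Config N d => ω v) inferInstance

lemma sigmaOn_mono {N d : ℕ} {S T : Set (Vertex N d)} (h : S ⊆ T) : sigmaOn S ≤ sigmaOn T :=
  biSup_mono h

lemma sigmaOn_le {N d : ℕ} (S : Set (Vertex N d)) :
    sigmaOn S ≤ (inferInstance : MeasurableSpace (Config N d)) :=
  iSup₂_le fun v _ => (measurable_pi_apply v).comap_le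

/-- The event is a finite union of cylinders, one for each admissible pattern on `S`. So goodness is
measurable although it quantifies over uncountably many lines. -/
lemma measurableSet_sigmaOn {N d : ℕ} {S : Set (Vertex N d)} (hS : S.Finite)
    {A : Set (Config N d)} (h : DependsOn (fun ω => ω ∈ A) S) : MeasurableSet[sigmaOn S] A := by
  have := hS.to_subtype
  have hA : A = ⋃ f ∈ {f : S → Bool | ∃ ω ∈ A, ∀ v : S, ω v = f v},
      ⋂ v : S, (fun ω : Config N d => ω v) ⁻¹' {f v} := by
    ext ω
    simp only [Set.mem_iUnion, Set.mem_iInter, Set.mem_preimage, Set.mem_singleton_iff]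
    constructor
    · intro hω
      exact ⟨fun v => ω v, ⟨ω, hω, fun _ => rfl⟩, fun _ => rfl⟩
    · rintro ⟨f, ⟨ω', hω', hf⟩, hω⟩
      have : (ω' ∈ A) = (ω ∈ A) := h fun v hv => (hf ⟨v, hv⟩).trans (hω ⟨v, hv⟩).symm
      rwa [← this]
  rw [hA]
  refine MeasurableSet.biUnion (Set.to_countable _) fun f _ => MeasurableSet.iInter fun v => ?_
  have hle : MeasurableSpace.comap (fun ω : Config N d => ω v) inferInstance ≤ sigmaOn S :=
    le_iSup₂_of_le (v : Vertex N d) v.2 le_rfl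
  exact hle _ ⟨{f v}, MeasurableSet.of_discrete, rfl⟩

instance {N d : ℕ} {p : unitInterval} : IsProbabilityMeasure (percolationMeasure N d p) := by
  unfold percolationMeasure; infer_instance

lemma measure_inter_of_disjoint {N d : ℕ} (p : unitInterval) {S T : Set (Vertex N d)}
    (hST : Disjoint S T) {A B : Set (Config N d)} (hA : MeasurableSet[sigmaOn S] A)
    (hB : MeasurableSet[sigmaOn T] B) :
    (percolationMeasure N d p).real (A ∩ B) =
      (percolationMeasure N d p).real A * (percolationMeasure N d p).real B := by
  have h1 : ProbabilityTheory.iIndepFun (fun (v : Vertex N d) (ω : Config N d) => ω v)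
      (percolationMeasure N d p) :=
    ProbabilityTheory.iIndepFun_infinitePi (X := fun _ => id) fun _ => measurable_id
  have h2 : ProbabilityTheory.Indep (sigmaOn S) (sigmaOn T) (percolationMeasure N d p) :=
    ProbabilityTheory.indep_iSup_of_disjoint (fun v => (measurable_pi_apply v).comap_le) h1 hST
  rw [measureReal_def, (ProbabilityTheory.Indep_iff _ _ _).1 h2 A B hA hB, ENNReal.toReal_mul]
  rfl

lemma measure_biInter_of_disjoint {N d : ℕ} (p : unitInterval) {ι : Type*} (F : Finset ι)
    (S : ι → Set (Vertex N d)) (A : ι → Set (Config N d))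
    (hS : (F : Set ι).PairwiseDisjoint S) (hA : ∀ j ∈ F, MeasurableSet[sigmaOn (S j)] (A j)) :
    (percolationMeasure N d p).real (⋂ j ∈ F, A j) =
      ∏ j ∈ F, (percolationMeasure N d p).real (A j) := by
  classical
  induction F using Finset.induction_on with
  | empty => simp
  | insert a F ha ih =>
    rw [Finset.set_biInter_insert, Finset.prod_insert ha,
      measure_inter_of_disjoint p (S := S a) (T := ⋃ j ∈ F, S j) _ (hA a (by simp)) _, ih]
    · exact hS.subset (by simp)
    · exact fun j hj => hA j (by simp [hj])
    · rw [Set.disjoint_iUnion₂_right]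
      intro j hj
      exact hS (by simp) (by simp [hj]) (by rintro rfl; exact ha hj)
    · exact MeasurableSet.biInter F.countable_toSet fun j hj =>
        sigmaOn_mono (Set.subset_biUnion_of_mem (u := S) hj) _
          (hA j (Finset.mem_insert_of_mem hj))

lemma measure_all_deleted {N d : ℕ} (p : unitInterval) (F : Finset (Vertex N d)) :
    (percolationMeasure N d p).real {ω | ∀ v ∈ F, ω v = false} = (1 - (p : ℝ)) ^ F.card := by
  have h : {ω : Config N d | ∀ v ∈ F, ω v = false} = Set.pi F fun _ => {false} := by
    ext ω; simp [Set.mem_pi]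
  rw [h, measureReal_def, percolationMeasure,
    Measure.infinitePi_pi _ fun _ _ => MeasurableSet.of_discrete, ENNReal.toReal_prod]
  rw [Finset.prod_congr rfl (g := fun _ => 1 - (p : ℝ)), Finset.prod_const]
  intro v _
  rw [← measureReal_def, ProbabilityTheory.bernoulliMeasure_real_apply _ MeasurableSet.of_discrete]
  simp

/-! ### Lines that run through a cube -/

/-- On an interval of length `1`, an affine function of slope at most `1` switches at most once
between adjacent unit intervals with integer end points. -/
lemma exists_switching_point {A B : ℤ} (hAB : A < B) {b u k : ℝ} (hu : |u| ≤ 1)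
    (h : ∀ s ∈ Icc k (k + 1), (A : ℝ) ≤ b + s * u ∧ b + s * u ≤ B) :
    ∃ t : ℝ, ∀ α β : ℝ, k ≤ α → β ≤ k + 1 → t ∉ Ioo α β →
      ∃ c : ℤ, A ≤ c ∧ c + 1 ≤ B ∧ ∀ s ∈ Ioo α β, (c : ℝ) ≤ b + s * u ∧ b + s * u ≤ c + 1 := by
  obtain ⟨hu1, hu2⟩ := abs_le.1 hu
  obtain ⟨m, hm, hmA, hmb⟩ : ∃ m : ℝ, (∀ s ∈ Icc k (k + 1), m ≤ b + s * u ∧ b + s * u ≤ m + 1) ∧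
      (A : ℝ) ≤ m ∧ (u = 0 → m = b) := by
    rcases le_total 0 u with h0 | h0
    · refine ⟨b + k * u, fun s hs => ⟨?_, ?_⟩, (h k ⟨le_rfl, by linarith⟩).1, ?_⟩
      · nlinarith [hs.1]
      · nlinarith [hs.1, hs.2]
      · rintro rfl; simp
    · refine ⟨b + (k + 1) * u, fun s hs => ⟨?_, ?_⟩, (h (k + 1) ⟨by linarith, le_rfl⟩).1, ?_⟩
      · nlinarith [hs.2]
      · nlinarith [hs.1, hs.2]
      · rintro rfl; simp
  -- The only integer in `(m, m + 1]`, hence the only one that the function can cross; the switching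
  -- point is the time of this crossing.
  set z : ℤ := ⌊m⌋ + 1 with hz
  have hz1 : (z : ℝ) - 1 ≤ m := by rw [hz]; push_cast; linarith [Int.floor_le m]
  have hz2 : m < z := by rw [hz]; push_cast; exact Int.lt_floor_add_one m
  have hAz : A < z := by
    have : (A : ℝ) < z := hmA.trans_lt hz2
    exact_mod_cast this
  rcases le_or_gt B z with hBz | hBz
  · refine ⟨k, fun α β hα hβ _ => ⟨B - 1, by omega, by omega, fun s hs => ?_⟩⟩
    have hs' : s ∈ Icc k (k + 1) := ⟨by linarith [hs.1], by linarith [hs.2]⟩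
    have h1 : (B : ℝ) ≤ z := by exact_mod_cast hBz
    push_cast
    exact ⟨by linarith [(hm s hs').1], by linarith [(h s hs').2]⟩
  · have lower : ∀ α β : ℝ, k ≤ α → β ≤ k + 1 → (∀ s ∈ Ioo α β, b + s * u ≤ z) →
        ∃ c : ℤ, A ≤ c ∧ c + 1 ≤ B ∧ ∀ s ∈ Ioo α β, (c : ℝ) ≤ b + s * u ∧ b + s * u ≤ c + 1 := by
      intro α β hα hβ hle
      refine ⟨z - 1, by omega, by omega, fun s hs => ?_⟩
      have hs' : s ∈ Icc k (k + 1) := ⟨by linarith [hs.1], by linarith [hs.2]⟩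
      push_cast
      exact ⟨by linarith [(hm s hs').1], by linarith [hle s hs]⟩
    have upper : ∀ α β : ℝ, k ≤ α → β ≤ k + 1 → (∀ s ∈ Ioo α β, (z : ℝ) ≤ b + s * u) →
        ∃ c : ℤ, A ≤ c ∧ c + 1 ≤ B ∧ ∀ s ∈ Ioo α β, (c : ℝ) ≤ b + s * u ∧ b + s * u ≤ c + 1 := by
      intro α β hα hβ hle
      refine ⟨z, by omega, by omega, fun s hs => ⟨hle s hs, ?_⟩⟩
      have hs' : s ∈ Icc k (k + 1) := ⟨by linarith [hs.1], by linarith [hs.2]⟩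
      linarith [(hm s hs').2]
    rcases lt_trichotomy u 0 with h0 | h0 | h0
    · refine ⟨(z - b) / u, fun α β hα hβ ht => ?_⟩
      have hut : (z - b) / u * u = z - b := div_mul_cancel₀ _ h0.ne
      rcases le_or_gt ((z - b) / u) α with h1 | h1
      · exact lower α β hα hβ fun s hs => by nlinarith [hs.1]
      · have h2 : β ≤ (z - b) / u := by by_contra! h3; exact ht ⟨h1, h3⟩
        exact upper α β hα hβ fun s hs => by nlinarith [hs.2]
    · refine ⟨k, fun α β hα hβ _ => lower α β hα hβ fun s _ => ?_⟩
      rw [h0, mul_zero, add_zero, ← hmb h0]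
      exact hz2.le
    · refine ⟨(z - b) / u, fun α β hα hβ ht => ?_⟩
      have hut : (z - b) / u * u = z - b := div_mul_cancel₀ _ h0.ne'
      rcases le_or_gt ((z - b) / u) α with h1 | h1
      · exact upper α β hα hβ fun s hs => by nlinarith [hs.1]
      · have h2 : β ≤ (z - b) / u := by by_contra! h3; exact ht ⟨h1, h3⟩
        exact lower α β hα hβ fun s hs => by nlinarith [hs.2]

/-- Pigeonhole: the at most `d - 1` points `t j` with `j ≠ i` cannot hit all `d` disjoint open
intervals of length `1/d`. This matches the factor `d⁻¹` in the notion of proper intersection. -/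
lemma exists_subinterval {d : ℕ} (i : Fin d) (t : Fin d → ℝ) (k : ℝ) :
    ∃ α : ℝ, k ≤ α ∧ α + (d : ℝ)⁻¹ ≤ k + 1 ∧ ∀ j ≠ i, t j ∉ Ioo α (α + (d : ℝ)⁻¹) := by
  have hd : (0 : ℝ) < d := by exact_mod_cast i.pos
  by_contra! hcon
  have key : ∀ m : Fin d, ∃ j ≠ i, t j ∈ Ioo (k + (m : ℕ) * (d : ℝ)⁻¹)
      (k + (m : ℕ) * (d : ℝ)⁻¹ + (d : ℝ)⁻¹) := by
    intro m
    refine hcon _ (by have : 0 ≤ ((m : ℕ) : ℝ) * (d : ℝ)⁻¹ := by positivity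
                      linarith) ?_
    have h1 : (((m : ℕ) : ℝ) + 1) * (d : ℝ)⁻¹ ≤ d * (d : ℝ)⁻¹ := by
      gcongr
      exact_mod_cast m.2
    rw [mul_inv_cancel₀ hd.ne'] at h1
    linarith
  choose J hJ hJt using key
  have hinj : Function.Injective J := by
    have aux : ∀ m m' : Fin d, J m = J m' → (m : ℕ) ≤ (m' : ℕ) := by
      intro m m' hmm
      have h1 := (hJt m).1
      have h2 := (hJt m').2
      rw [hmm] at h1
      have h3 : ((m : ℕ) : ℝ) * (d : ℝ)⁻¹ < (((m' : ℕ) : ℝ) + 1) * (d : ℝ)⁻¹ := by linarith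
      have h4 := lt_of_mul_lt_mul_right h3 (by positivity)
      have : (m : ℕ) < (m' : ℕ) + 1 := by exact_mod_cast h4
      omega
    exact fun m m' h => Fin.ext (le_antisymm (aux _ _ h) (aux _ _ h.symm))
  obtain ⟨m, hm⟩ := Finite.surjective_of_injective hinj i
  exact hJ m hm

/-- The piece over a unit interval of a line of slope at most `1` runs through some cube for at
least `1 / d` of the time. -/
lemma exists_column_of_line {d : ℕ} (i : Fin d) {A B : Fin d → ℤ} (hAB : ∀ j, A j < B j)
    {b u : Fin d → ℝ} {k : ℝ} (hu : ∀ j, |u j| ≤ 1)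
    (h : ∀ j, ∀ s ∈ Icc k (k + 1), (A j : ℝ) ≤ b j + s * u j ∧ b j + s * u j ≤ B j) :
    ∃ (α : ℝ) (c : Fin d → ℤ), k ≤ α ∧ α + (d : ℝ)⁻¹ ≤ k + 1 ∧ ∀ j ≠ i,
      A j ≤ c j ∧ c j + 1 ≤ B j ∧ ∀ s ∈ Ioo α (α + (d : ℝ)⁻¹),
        (c j : ℝ) ≤ b j + s * u j ∧ b j + s * u j ≤ c j + 1 := by
  choose t ht using fun j => exists_switching_point (hAB j) (hu j) (h j)
  obtain ⟨α, hα, hα', hsub⟩ := exists_subinterval i t k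
  have key : ∀ j, ∃ c : ℤ, j ≠ i → A j ≤ c ∧ c + 1 ≤ B j ∧ ∀ s ∈ Ioo α (α + (d : ℝ)⁻¹),
      (c : ℝ) ≤ b j + s * u j ∧ b j + s * u j ≤ c + 1 := by
    intro j
    by_cases hj : j = i
    · exact ⟨0, fun h => absurd hj h⟩
    · obtain ⟨c, hc⟩ := ht j α _ hα hα' (hsub j hj)
      exact ⟨c, fun _ => hc⟩
  choose c hc using key
  exact ⟨α, c, hα, hα', hc⟩

lemma le_hausdorffMeasure_image {d : ℕ} (i : Fin d) {A : Set (Space d)} {α β τ : ℝ} (hτ : 0 < τ)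
    (h : ∀ s ∈ Ioo α β, ∃ x ∈ A, x i = s * τ) :
    ENNReal.ofReal ((β - α) * τ) ≤
      Measure.hausdorffMeasure (1 : ℝ) ((fun x : Space d => x i) '' A) := by
  rw [hausdorffMeasure_real, sub_mul, ← Real.volume_Ioo]
  refine measure_mono fun y hy => ?_
  obtain ⟨x, hx, hxi⟩ := h (y / τ) ⟨(lt_div_iff₀ hτ).2 hy.1, (div_lt_iff₀ hτ).2 hy.2⟩
  exact ⟨x, hx, hxi.trans (div_mul_cancel₀ _ hτ.ne')⟩

lemma hausdorffMeasure_pos {d : ℕ} (i : Fin d) {A : Set (Space d)} {α β τ : ℝ} (hτ : 0 < τ)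
    (hαβ : α < β) (h : ∀ s ∈ Ioo α β, ∃ x ∈ A, x i = s * τ) :
    0 < Measure.hausdorffMeasure (1 : ℝ) A := by
  have hlip : LipschitzWith 1 fun x : Space d => x i := by
    refine LipschitzWith.of_dist_le_mul fun x y => ?_
    rw [NNReal.coe_one, one_mul, dist_eq_norm, dist_eq_norm]
    exact PiLp.norm_apply_le (x - y) i
  have h1 := hlip.hausdorffMeasure_image_le zero_le_one A
  simp only [ENNReal.coe_one, ENNReal.one_rpow, one_mul] at h1
  refine lt_of_lt_of_le ?_ ((le_hausdorffMeasure_image i hτ h).trans h1)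
  rw [ENNReal.ofReal_pos]
  exact mul_pos (sub_pos.2 hαβ) hτ

/-- A line that intersects a cube properly, parametrized by its principle coordinate in units of
the side length of the cubes of level `n + m`. -/
lemma IntersectsProperly.exists_param {N d n : ℕ} (hN : 2 ≤ N) (m : ℕ) {Q : GridCube N d n}
    {ℓ : AffineSubspace ℝ (Space d)} {i : Fin d} (h : IntersectsProperly ℓ Q)
    (hi : IsPrincipleDirection ℓ i) :
    ∃ (b u : Fin d → ℝ) (s₀ s₁ : ℝ), b i = 0 ∧ u i = 1 ∧ (∀ j, |u j| ≤ 1) ∧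
      ((N ^ m : ℕ) : ℝ) < 2 * d * (s₁ - s₀) ∧
      (∀ s, ∃ x ∈ ℓ, ∀ j, x j = (b j + s * u j) * side N (n + m)) ∧
      ∀ j, ∀ s ∈ Icc s₀ s₁,
        (((Q.corner j : ℕ) * N ^ m : ℕ) : ℝ) ≤ b j + s * u j ∧
        b j + s * u j ≤ ((((Q.corner j : ℕ) + 1) * N ^ m : ℕ) : ℝ) := by
  have hd : (0 : ℝ) < d := by exact_mod_cast i.pos
  set τ := side N (n + m) with hτ
  have hτ0 : 0 < τ := side_pos hN _
  have hσ : side N n = ((N ^ m : ℕ) : ℝ) * τ := side_eq_mul hN n m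
  have hσ0 := side_pos hN n
  -- Only half of the guaranteed length is claimed, so that the strict inequality follows from
  -- comparing measure with diameter.
  obtain ⟨p, hp, p', hp', hlt⟩ : ∃ p ∈ (ℓ : Set (Space d)) ∩ Q.toSet,
      ∃ p' ∈ (ℓ : Set (Space d)) ∩ Q.toSet, side N n < 2 * d * (p' i - p i) := by
    obtain ⟨i', hi', hle⟩ := h
    by_contra! hcon
    rw [hausdorffMeasure_real] at hle
    have h1 := hle.trans (Real.volume_le_diam _)
    have h2 : Metric.ediam ((fun x : Space d => x i') '' ((ℓ : Set (Space d)) ∩ Q.toSet)) ≤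
        ENNReal.ofReal (side N n / (2 * d)) := by
      refine Metric.ediam_le ?_
      rintro _ ⟨p, hp, rfl⟩ _ ⟨p', hp', rfl⟩
      rw [edist_dist]
      refine ENNReal.ofReal_le_ofReal ?_
      rw [Real.dist_eq]
      refine (hi p hp.1 p' hp'.1 i').trans ?_
      rw [le_div_iff₀ (by positivity)]
      rcases abs_cases (p i - p' i) with h | h
      · rw [h.1]; linarith [hcon p' hp' p hp]
      · rw [h.1]; linarith [hcon p hp p' hp']
    have h3 := (ENNReal.ofReal_le_ofReal_iff (by positivity)).1 (h1.trans h2)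
    have h4 : (d : ℝ)⁻¹ * side N n = 2 * (side N n / (2 * d)) := by field_simp
    have h5 : 0 < side N n / (2 * d) := by positivity
    linarith
  have hpos : 0 < p' i - p i := by
    have : 0 < 2 * d * (p' i - p i) := hσ0.trans hlt
    exact pos_of_mul_pos_right this (by positivity)
  set u : Fin d → ℝ := fun j => (p' j - p j) / (p' i - p i) with hu
  have hui : u i = 1 := div_self hpos.ne'
  set b : Fin d → ℝ := fun j => p j / τ - p i / τ * u j with hb
  have e₀ : ∀ j, b j + p i / τ * u j = p j / τ := fun j => by simp only [hb]; ring
  have e₁ : ∀ j, b j + p' i / τ * u j = p' j / τ := fun j => by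
    simp only [hb, hu]; field_simp; ring
  have hu1 : ∀ j, |u j| ≤ 1 := by
    intro j
    simp only [hu]
    rw [abs_div, div_le_one (abs_pos.2 hpos.ne')]
    exact hi p' hp'.1 p hp.1 j
  refine ⟨b, u, p i / τ, p' i / τ, ?_, hui, hu1, ?_, ?_, ?_⟩
  · simp only [hb]; rw [hui]; ring
  · rw [hσ] at hlt
    rw [← sub_div, ← mul_div_assoc, lt_div_iff₀ hτ0]
    exact hlt
  · intro s
    refine ⟨AffineMap.lineMap p p' ((s * τ - p i) / (p' i - p i)),
      AffineMap.lineMap_mem _ hp.1 hp'.1, fun j => ?_⟩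
    rw [AffineMap.lineMap_apply]
    simp only [hb, hu, vsub_eq_sub, vadd_eq_add, PiLp.add_apply, PiLp.smul_apply, PiLp.sub_apply,
      smul_eq_mul]
    field_simp
    ring
  · intro j s hs
    have q₀ := hp.2 j
    have q₁ := hp'.2 j
    rw [hσ, ← mul_assoc, ← mul_assoc, ← le_div_iff₀ hτ0, ← div_le_iff₀ hτ0, ← e₀ j] at q₀
    rw [hσ, ← mul_assoc, ← mul_assoc, ← le_div_iff₀ hτ0, ← div_le_iff₀ hτ0, ← e₁ j] at q₁
    push_cast at q₀ q₁ ⊢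
    rcases le_total 0 (u j) with h0 | h0
    · have h1 := mul_le_mul_of_nonneg_right hs.1 h0
      have h2 := mul_le_mul_of_nonneg_right hs.2 h0
      exact ⟨by linarith, by linarith⟩
    · have h1 := mul_le_mul_of_nonpos_right hs.1 h0
      have h2 := mul_le_mul_of_nonpos_right hs.2 h0
      exact ⟨by linarith, by linarith⟩

/-! ### Blocks of deleted cubes along a line -/

open Classical in
/-- The cubes of level `M` in the `k`-th layer in direction `i` whose corner is near `c`. -/
def block {d : ℕ} (N M : ℕ) (i : Fin d) (k : ℕ) (c : Fin d → ℤ) : Finset (GridCube N d M) :=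
  Finset.univ.filter fun Q => (Q.corner i : ℕ) = k ∧
    ∀ j, j ≠ i → c j - 6 ≤ ((Q.corner j : ℕ) : ℤ) ∧ ((Q.corner j : ℕ) : ℤ) ≤ c j + 6

lemma corner_of_subset_layer {N d n : ℕ} (hN : 2 ≤ N) {Q : GridCube N d n} {i : Fin d}
    {k : Fin (N ^ n)} (h : Q.toSet ⊆ layer N n i k) : Q.corner i = k := by
  have hs := side_pos hN n
  have h0 := (h (Q.point_mem hN le_rfl zero_le_one)).1
  have h1 := (h (Q.point_mem hN zero_le_one le_rfl)).2
  simp only [GridCube.point] at h0 h1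
  replace h0 := le_of_mul_le_mul_right h0 hs
  replace h1 := le_of_mul_le_mul_right h1 hs
  have h0' : (k : ℕ) ≤ (Q.corner i : ℕ) := by rw [add_zero] at h0; exact_mod_cast h0
  have h1' : (Q.corner i : ℕ) + 1 ≤ (k : ℕ) + 1 := by exact_mod_cast h1
  exact Fin.ext (by omega)

/-- A `block` has margin `6`: the rounding error `5` of `path_near`, and `1` for the neighbours that
strong deletion involves. -/
lemma stronglyDeleted_of_block {N d M : ℕ} (hN : 2 ≤ N) {ω : Config N d} {i : Fin d}
    {Q : GridCube N d M} {c : Fin d → ℤ}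
    (hQ : ∀ j, j ≠ i → c j - 5 ≤ ((Q.corner j : ℕ) : ℤ) ∧ ((Q.corner j : ℕ) : ℤ) ≤ c j + 5)
    (h : ∀ R ∈ block N M i (Q.corner i : ℕ) c, ω ⟨M, R⟩ = false) : StronglyDeleted ω i Q := by
  rintro R ⟨hR, k, hk, hk'⟩
  refine h R ?_
  simp only [block, Finset.mem_filter, Finset.mem_univ, true_and]
  refine ⟨by rw [corner_of_subset_layer hN hk, corner_of_subset_layer hN hk'], fun j hj => ?_⟩
  have h1 := hR.corner_le hN j
  have h2 := hQ j hj
  omega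

/-- The integer path with slopes `ζ / K`. -/
def path {d : ℕ} (K : ℕ) (β ζ : Fin d → ℤ) (t : ℕ) (j : Fin d) : ℤ := β j + t * ζ j / K

/-- Five errors of at most one unit each: rounding `y`, rounding the slope (at most `1 / K` in each
of `t ≤ K` steps), the integer division, the drift `w * u` inside the layer, and the width of the
cell `[c, c + 1]`. -/
lemma path_near {K t : ℕ} (hK : 0 < K) (htK : t ≤ K) {y u w : ℝ} (hu : |u| ≤ 1) (hw0 : 0 ≤ w)
    (hw1 : w ≤ 1) {c : ℤ} (h0 : (c : ℝ) ≤ y + t * u + w * u) (h1 : y + t * u + w * u ≤ c + 1) :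
    ⌊y⌋ + t * ⌊K * u⌋ / K - 5 ≤ c ∧ c ≤ ⌊y⌋ + t * ⌊K * u⌋ / K + 5 := by
  have hKR : (0 : ℝ) < K := by exact_mod_cast hK
  obtain ⟨hu1, hu2⟩ := abs_le.1 hu
  set ζ := ⌊(K : ℝ) * u⌋ with hζ
  have hβ1 := Int.floor_le y
  have hβ2 := Int.lt_floor_add_one y
  have hζ1 : (ζ : ℝ) ≤ K * u := Int.floor_le _
  have hζ2 : K * u < ζ + 1 := Int.lt_floor_add_one _
  set q : ℤ := t * ζ / K with hq
  have hKZ : (0 : ℤ) < K := by exact_mod_cast hK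
  have hq1 : (K : ℝ) * q ≤ t * ζ := by
    have := Int.mul_ediv_self_le (x := (t : ℤ) * ζ) hKZ.ne'
    exact_mod_cast this
  have hq2 : (t : ℝ) * ζ < K * q + K := by
    have := Int.lt_mul_ediv_self_add (x := (t : ℤ) * ζ) hKZ
    exact_mod_cast this
  have htK : (t : ℝ) ≤ K := by exact_mod_cast htK
  have ht0 : (0 : ℝ) ≤ t := Nat.cast_nonneg t
  have n1 := mul_le_mul_of_nonneg_left hζ1 ht0
  have n2 := mul_le_mul_of_nonneg_left hζ2.le ht0
  have m1 : (q : ℝ) ≤ t * u := by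
    refine le_of_mul_le_mul_left ?_ hKR
    linarith
  have m2 : (t : ℝ) * u ≤ q + 2 := by
    refine le_of_mul_le_mul_left ?_ hKR
    linarith
  have m4 : -1 ≤ w * u := by nlinarith
  have m5 : w * u ≤ 1 := by nlinarith
  have e1 : ((⌊y⌋ + q - 5 : ℤ) : ℝ) ≤ c := by push_cast; linarith
  have e2 : (c : ℝ) ≤ ((⌊y⌋ + q + 5 : ℤ) : ℝ) := by push_cast; linarith
  exact ⟨by exact_mod_cast e1, by exact_mod_cast e2⟩

lemma not_isExtremal {M k : ℕ} {J : Set (Fin M)} (hk : 2 ≤ k) (hkM : k + 2 < M)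
    (h : ∀ l : Fin M, k ≤ (l : ℕ) + 2 → (l : ℕ) ≤ k + 2 → l ∈ J) {l : Fin M} (hl : (l : ℕ) = k) :
    ¬ IsExtremal J l := by
  rintro ⟨-, h' | h'⟩
  · have h2 : ({⟨k - 1, by omega⟩, ⟨k - 2, by omega⟩} : Set (Fin M)) ⊆ {j ∈ J | j < l} := by
      rintro x (rfl | rfl)
      · exact ⟨h _ (by simp only; omega) (by simp only; omega),
          by rw [Fin.lt_def, hl]; simp only; omega⟩
      · exact ⟨h _ (by simp only; omega) (by simp only; omega),
          by rw [Fin.lt_def, hl]; simp only; omega⟩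
    have h3 := Set.ncard_le_ncard h2 (Set.toFinite _)
    rw [Set.ncard_pair (by rw [Ne, Fin.mk.injEq]; omega)] at h3
    omega
  · have h2 : ({⟨k + 1, by omega⟩, ⟨k + 2, by omega⟩} : Set (Fin M)) ⊆ {j ∈ J | l < j} := by
      rintro x (rfl | rfl)
      · exact ⟨h _ (by simp only; omega) (by simp only; omega),
          by rw [Fin.lt_def, hl]; simp only; omega⟩
      · exact ⟨h _ (by simp only; omega) (by simp only; omega),
          by rw [Fin.lt_def, hl]; simp only; omega⟩
    have h3 := Set.ncard_le_ncard h2 (Set.toFinite _)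
    rw [Set.ncard_pair (by rw [Ne, Fin.mk.injEq]; omega)] at h3
    omega

/-- If along every integer path through `Q` there is a block of deleted cubes, `Q` is good. -/
lemma isGood_of_forall_path {N d n m r : ℕ} (hN : 2 ≤ N) (hr : 2 * d * (r + 8) ≤ N ^ m)
    (Q : GridCube N d n) (ω : Config N d)
    (h : ∀ (i : Fin d) (κ : ℕ) (β ζ : Fin d → ℤ),
      κ ∈ Finset.Icc ((Q.corner i : ℕ) * N ^ m) (((Q.corner i : ℕ) + 1) * N ^ m) →
      (∀ j, β j ∈ Finset.Icc ((Q.corner j : ℕ) * N ^ m : ℤ) (((Q.corner j : ℕ) + 1) * N ^ m : ℤ)) →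
      (∀ j, ζ j ∈ Finset.Icc (-(N ^ m : ℕ) : ℤ) (N ^ m : ℕ)) →
      ∃ t < r, ∀ R ∈ block N (n + m) i (κ + t) (path (N ^ m) β ζ t), ω ⟨n + m, R⟩ = false) :
    IsGood ω m Q := by
  intro ℓ _ hℓ _ i hi
  obtain ⟨b, u, s₀, s₁, hbi, hui, hu, hlen, hpt, hbox⟩ := hℓ.exists_param hN m hi
  set τ := side N (n + m) with hτ
  have hτ0 : 0 < τ := side_pos hN _
  have hd : 0 < d := i.pos
  have hdR : (0 : ℝ) < d := by exact_mod_cast hd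
  set K := N ^ m with hK
  have hKpos : 0 < K := by positivity
  have hKR : (0 : ℝ) < K := by exact_mod_cast hKpos
  have hrK : r ≤ K := by nlinarith
  -- Room for `r` layers, plus a margin for rounding and for two further layers at either end, which
  -- keeps the cube found out of the extremal layers.
  have hlen' : s₀ + (r + 8) < s₁ := by
    have h1 : (2 * d * (r + 8) : ℝ) ≤ K := by exact_mod_cast hr
    have h2 := lt_of_mul_lt_mul_left (h1.trans_lt hlen) (by positivity)
    linarith
  have hs₀ : (((Q.corner i : ℕ) * K : ℕ) : ℝ) ≤ s₀ := by
    have := (hbox i s₀ ⟨le_rfl, by linarith [(Nat.cast_nonneg r : (0 : ℝ) ≤ r)]⟩).1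
    rwa [hbi, hui, mul_one, zero_add] at this
  have hs₁ : s₁ ≤ ((((Q.corner i : ℕ) + 1) * K : ℕ) : ℝ) := by
    have := (hbox i s₁ ⟨by linarith [(Nat.cast_nonneg r : (0 : ℝ) ≤ r)], le_rfl⟩).2
    rwa [hbi, hui, mul_one, zero_add] at this
  have hs₀0 : 0 ≤ s₀ := (Nat.cast_nonneg _).trans hs₀
  set κ : ℕ := ⌈s₀⌉₊ + 2 with hκ
  have hκ1 : s₀ + 2 ≤ κ := by rw [hκ]; push_cast; linarith [Nat.le_ceil s₀]
  have hκ2 : (κ : ℝ) < s₀ + 3 := by rw [hκ]; push_cast; linarith [Nat.ceil_lt_add_one hs₀0]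
  have hκI : (κ : ℝ) ∈ Icc s₀ s₁ :=
    ⟨by linarith, by linarith [(Nat.cast_nonneg r : (0 : ℝ) ≤ r)]⟩
  -- The line is discretized: its position over the layer boundary `κ` is rounded to an integer, its
  -- slope to a multiple of `1 / K`.
  obtain ⟨t, htr, hblock⟩ := h i κ (fun j => ⌊b j + κ * u j⌋) (fun j => ⌊K * u j⌋)
    (by
      rw [Finset.mem_Icc]
      constructor
      · have := hs₀.trans hκI.1; exact_mod_cast this
      · have := hκI.2.trans hs₁; exact_mod_cast this)
    (fun j => by
      have h1 := hbox j κ hκI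
      rw [Finset.mem_Icc]
      constructor
      · rw [Int.le_floor]; push_cast at h1 ⊢; exact_mod_cast h1.1
      · have h2 := (Int.floor_le (b j + κ * u j)).trans h1.2
        have h3 : ⌊b j + κ * u j⌋ ≤ ((((Q.corner j : ℕ) + 1) * K : ℕ) : ℤ) := by exact_mod_cast h2
        rw [hK] at h3
        push_cast at h3 ⊢
        exact h3)
    (fun j => by
      obtain ⟨h1, h2⟩ := abs_le.1 (hu j)
      rw [Finset.mem_Icc]
      constructor
      · rw [Int.le_floor]; push_cast; nlinarith
      · have h3 : ((⌊(K : ℝ) * u j⌋ : ℤ) : ℝ) ≤ (K : ℝ) :=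
          (Int.floor_le _).trans (by nlinarith)
        exact_mod_cast h3)
  set k : ℕ := κ + t with hk
  have hkR : (k : ℝ) = κ + t := by rw [hk]; push_cast; ring
  have htR : (t : ℝ) + 1 ≤ r := by exact_mod_cast htr
  have ht0 : (0 : ℝ) ≤ t := Nat.cast_nonneg t
  have hk0 : s₀ + 2 ≤ k := by linarith
  have hk1 : (k : ℝ) + 3 ≤ s₁ := by linarith
  have hAB : ∀ j, (((Q.corner j : ℕ) * K : ℕ) : ℤ) < ((((Q.corner j : ℕ) + 1) * K : ℕ) : ℤ) := by
    intro j
    have : (Q.corner j : ℕ) * K < ((Q.corner j : ℕ) + 1) * K :=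
      Nat.mul_lt_mul_of_pos_right (Nat.lt_succ_self _) hKpos
    exact_mod_cast this
  obtain ⟨α, c, hα, hα', hc⟩ := exists_column_of_line i (k := k) (u := u) (b := b) hAB hu
    (fun j s hs => by
      have := hbox j s ⟨by linarith [hs.1], by linarith [hs.2]⟩
      exact_mod_cast this)
  have hkQ0 : (Q.corner i : ℕ) * K ≤ k := by
    have : (((Q.corner i : ℕ) * K : ℕ) : ℝ) ≤ k := by linarith
    exact_mod_cast this
  have hkQ1 : k + 3 ≤ ((Q.corner i : ℕ) + 1) * K := by
    have : ((k + 3 : ℕ) : ℝ) ≤ ((((Q.corner i : ℕ) + 1) * K : ℕ) : ℝ) := by push_cast at *; linarith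
    exact_mod_cast this
  have hQlt : ∀ j, ((Q.corner j : ℕ) + 1) * K ≤ N ^ (n + m) := by
    intro j
    rw [pow_add]
    exact Nat.mul_le_mul_right _ (Q.corner j).2
  have hex : ∀ j, ∃ a : Fin (N ^ (n + m)), (j = i → (a : ℕ) = k) ∧ (j ≠ i → ((a : ℕ) : ℤ) = c j) := by
    intro j
    by_cases hj : j = i
    · exact ⟨⟨k, by have := hQlt i; omega⟩, fun _ => rfl, fun h => absurd hj h⟩
    · obtain ⟨h1, h2, -⟩ := hc j hj
      refine ⟨⟨(c j).toNat, ?_⟩, fun h => absurd h hj, fun _ => ?_⟩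
      · have := hQlt j; omega
      · show ((c j).toNat : ℤ) = c j
        omega
  choose a hai haj using hex
  set Q' : GridCube N d (n + m) := ⟨a⟩ with hQ'
  have hQ'i : (Q'.corner i : ℕ) = k := hai i rfl
  have hsub : Q'.toSet ⊆ Q.toSet := by
    rw [GridCube.subset_iff hN]
    intro j
    by_cases hj : j = i
    · subst hj
      rw [hQ'i, ← hK]
      omega
    · obtain ⟨h1, h2, -⟩ := hc j hj
      have h3 : ((Q'.corner j : ℕ) : ℤ) = c j := haj j hj
      constructor
      · rw [← h3] at h1; exact_mod_cast h1
      · rw [← h3] at h2; exact_mod_cast h2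
  refine ⟨Q', hsub, ?_, ?_, ⟨i, hi, ?_⟩⟩
  · refine stronglyDeleted_of_block hN (fun j hj => ?_) (hQ'i.symm ▸ hblock)
    have h3 : ((Q'.corner j : ℕ) : ℤ) = c j := haj j hj
    rw [h3]
    have hdi : 0 < (d : ℝ)⁻¹ := by positivity
    obtain ⟨h4, h5⟩ := (hc j hj).2.2 (α + (d : ℝ)⁻¹ / 2) ⟨by linarith, by linarith⟩
    set s := α + (d : ℝ)⁻¹ / 2 with hs
    have m3 : b j + s * u j = (b j + κ * u j) + t * u j + (s - k) * u j := by rw [hkR]; ring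
    rw [m3] at h4 h5
    exact path_near hKpos (htr.le.trans hrK) (hu j) (by linarith) (by linarith) h4 h5
  · have hcross : ∀ l : Fin (N ^ (n + m)), s₀ ≤ (l : ℕ) → ((l : ℕ) : ℝ) + 1 ≤ s₁ →
        l ∈ crossedLayers m Q ℓ i := by
      intro l hl0 hl1
      refine hausdorffMeasure_pos i hτ0 (α := (l : ℕ)) (β := (l : ℕ) + 1) (by linarith) ?_
      intro s hs
      obtain ⟨x, hx, hxj⟩ := hpt s
      have hxi : x i = s * τ := by rw [hxj, hbi, hui, mul_one, zero_add]
      refine ⟨x, ⟨⟨hx, fun j => ?_⟩, ?_, ?_⟩, hxi⟩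
      · have h1 := hbox j s ⟨by linarith [hs.1], by linarith [hs.2]⟩
        rw [hxj, side_eq_mul hN n m, ← mul_assoc, ← mul_assoc]
        constructor
        · refine mul_le_mul_of_nonneg_right ?_ hτ0.le
          exact_mod_cast h1.1
        · refine mul_le_mul_of_nonneg_right ?_ hτ0.le
          exact_mod_cast h1.2
      · rw [hxi]; exact mul_le_mul_of_nonneg_right hs.1.le hτ0.le
      · rw [hxi]; exact mul_le_mul_of_nonneg_right hs.2.le hτ0.le
    intro l hl hQl
    have hlk : (l : ℕ) = k := by rw [← corner_of_subset_layer hN hQl, hQ'i]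
    have hbound := hQlt i
    refine not_isExtremal (by omega) (by omega) (fun l' h1 h2 => hcross l' ?_ ?_) hlk hl
    · have h1' : (k : ℝ) ≤ (l' : ℕ) + 2 := by exact_mod_cast h1
      linarith
    · have h2' : ((l' : ℕ) : ℝ) ≤ k + 2 := by exact_mod_cast h2
      linarith
  · have h1 := le_hausdorffMeasure_image i (A := (ℓ : Set (Space d)) ∩ Q'.toSet) hτ0
      (α := α) (β := α + (d : ℝ)⁻¹) ?_
    · rwa [add_sub_cancel_left] at h1
    · intro s hs
      obtain ⟨x, hx, hxj⟩ := hpt s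
      have hxi : x i = s * τ := by rw [hxj, hbi, hui, mul_one, zero_add]
      refine ⟨x, ⟨hx, fun j => ?_⟩, hxi⟩
      by_cases hj : j = i
      · subst hj
        rw [hxi, hQ'i]
        exact ⟨mul_le_mul_of_nonneg_right (by linarith [hs.1]) hτ0.le,
          mul_le_mul_of_nonneg_right (by linarith [hs.2]) hτ0.le⟩
      · have h3 : ((Q'.corner j : ℕ) : ℤ) = c j := haj j hj
        have h4 : ((Q'.corner j : ℕ) : ℝ) = c j := by exact_mod_cast h3
        obtain ⟨h5, h6⟩ := (hc j hj).2.2 s hs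
        rw [hxj, h4]
        exact ⟨mul_le_mul_of_nonneg_right h5 hτ0.le, mul_le_mul_of_nonneg_right h6 hτ0.le⟩

/-! ### The probability of bad cubes -/

lemma card_block_le {d : ℕ} (N M : ℕ) (i : Fin d) (k : ℕ) (c : Fin d → ℤ) :
    (block N M i k c).card ≤ 13 ^ d := by
  classical
  unfold block
  convert card_filter_le (fun Q : GridCube N d M => (Q.corner i : ℕ) = k ∧
    ∀ j, j ≠ i → c j - 6 ≤ ((Q.corner j : ℕ) : ℤ) ∧ ((Q.corner j : ℕ) : ℤ) ≤ c j + 6)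
    (fun j => if j = i then {(k : ℤ)} else Finset.Icc (c j - 6) (c j + 6)) 13
    (fun Q h j => ?_) fun j => ?_
  · by_cases hj : j = i
    · rw [if_pos hj, Finset.mem_singleton, hj, h.1]
    · rw [if_neg hj, Finset.mem_Icc]
      exact h.2 j hj
  · split_ifs
    · simp
    · rw [Int.card_Icc]; omega

lemma deletion_mem {p : unitInterval} (d : ℕ) (hp : p < 1) :
    0 ≤ 1 - (1 - (p : ℝ)) ^ 13 ^ d ∧ 1 - (1 - (p : ℝ)) ^ 13 ^ d < 1 := by
  have h0 : (0 : ℝ) < 1 - p := sub_pos.2 (by exact_mod_cast hp)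
  have h1 : 1 - (p : ℝ) ≤ 1 := by linarith [p.2.1]
  exact ⟨sub_nonneg.2 (pow_le_one₀ h0.le h1), by linarith [pow_pos h0 (13 ^ d)]⟩

/-- The blocks for different `t` lie in different layers, hence are disjoint, and the `r` failures
are independent. -/
lemma measure_path_le {N d : ℕ} (p : unitInterval) (M r κ : ℕ) (i : Fin d)
    (c : ℕ → Fin d → ℤ) :
    (percolationMeasure N d p).real
      {ω | ∀ t < r, ¬ ∀ R ∈ block N M i (κ + t) (c t), ω ⟨M, R⟩ = false} ≤
      (1 - (1 - (p : ℝ)) ^ 13 ^ d) ^ r := by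
  classical
  set F : ℕ → Finset (Vertex N d) := fun t =>
    (block N M i (κ + t) (c t)).image fun R => ⟨M, R⟩ with hF
  have hcard : ∀ t, (F t).card ≤ 13 ^ d := fun t =>
    Finset.card_image_le.trans (card_block_le _ _ _ _ _)
  set A : ℕ → Set (Config N d) := fun t => {ω | ∀ v ∈ F t, ω v = false} with hA
  have hmeas : ∀ t, MeasurableSet[sigmaOn (F t : Set (Vertex N d))] (A t) := fun t =>
    measurableSet_sigmaOn (F t).finite_toSet fun ω ω' h => by
      simp only [hA, Set.mem_ofPred_eq, eq_iff_iff]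
      exact forall₂_congr fun v hv => by rw [h v hv]
  have hset : {ω : Config N d | ∀ t < r, ¬ ∀ R ∈ block N M i (κ + t) (c t), ω ⟨M, R⟩ = false} =
      ⋂ t ∈ Finset.range r, (A t)ᶜ := by
    ext ω
    simp [hA, hF]
  rw [hset, measure_biInter_of_disjoint p _ (fun t => (F t : Set (Vertex N d)))]
  · calc ∏ t ∈ Finset.range r, (percolationMeasure N d p).real (A t)ᶜ
        ≤ ∏ _t ∈ Finset.range r, (1 - (1 - (p : ℝ)) ^ 13 ^ d) := by
          refine Finset.prod_le_prod (fun _ _ => measureReal_nonneg) fun t _ => ?_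
          rw [probReal_compl_eq_one_sub (sigmaOn_le _ _ (hmeas t)), hA, measure_all_deleted]
          exact sub_le_sub_left (pow_le_pow_of_le_one (sub_nonneg.2 p.2.2)
            (by linarith [p.2.1]) (hcard t)) _
      _ = _ := by simp
  · intro t _ t' _ htt'
    simp only [Function.onFun]
    rw [Finset.disjoint_coe, Finset.disjoint_left]
    intro v hv hv'
    simp only [hF, Finset.mem_image] at hv hv'
    obtain ⟨R, hR, rfl⟩ := hv
    obtain ⟨R', hR', h⟩ := hv'
    obtain rfl : R' = R := eq_of_heq (Sigma.mk.inj h).2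
    simp only [block, Finset.mem_filter, Finset.mem_univ, true_and] at hR hR'
    omega
  · exact fun t _ => (hmeas t).compl

/-- Union bound over the discretized lines. Positions are counted relative to the corner of `Q`, so
the number of paths does not depend on `n`. -/
lemma measure_not_isGood_le {N d n m r : ℕ} (p : unitInterval) (hN : 2 ≤ N)
    (hr : 2 * d * (r + 8) ≤ N ^ m) (Q : GridCube N d n) :
    (percolationMeasure N d p).real {ω | ¬ IsGood ω m Q} ≤
      (d * ((N ^ m + 1) * ((N ^ m + 1) ^ d * (2 * N ^ m + 1) ^ d)) : ℕ) *
        (1 - (1 - (p : ℝ)) ^ 13 ^ d) ^ r := by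
  set K := N ^ m with hK
  let I := Fin d × Fin (K + 1) × (Fin d → Fin (K + 1)) × (Fin d → Fin (2 * K + 1))
  let E : I → Set (Config N d) := fun a =>
    {ω | ∀ t < r, ¬ ∀ R ∈ block N (n + m) a.1 ((Q.corner a.1 : ℕ) * K + (a.2.1 : ℕ) + t)
      (path K (fun j => ((Q.corner j : ℕ) * K + (a.2.2.1 j : ℕ) : ℤ))
        (fun j => ((a.2.2.2 j : ℕ) : ℤ) - K) t), ω ⟨n + m, R⟩ = false}
  have hsub : {ω : Config N d | ¬ IsGood ω m Q} ⊆ ⋃ a ∈ (Finset.univ : Finset I), E a := by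
    intro ω hω
    by_contra hcon
    refine hω (isGood_of_forall_path hN hr Q ω fun i κ β ζ hκ hβ hζ => ?_)
    by_contra! hall
    apply hcon
    simp only [Finset.mem_univ, Set.iUnion_true, Set.mem_iUnion]
    rw [← hK] at hκ hζ hall
    rw [Finset.mem_Icc, add_mul, one_mul] at hκ
    have hβ' : ∀ j, ((Q.corner j : ℕ) : ℤ) * K ≤ β j ∧ β j ≤ (Q.corner j : ℕ) * K + K := fun j => by
      have := hβ j
      rw [Finset.mem_Icc, add_mul, one_mul] at this
      rw [hK]
      push_cast
      exact this
    have hζ' : ∀ j, -(K : ℤ) ≤ ζ j ∧ ζ j ≤ K := fun j => Finset.mem_Icc.1 (hζ j)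
    refine ⟨⟨i, ⟨κ - (Q.corner i : ℕ) * K, by omega⟩,
      fun j => ⟨(β j - (Q.corner j : ℕ) * K).toNat, by have := hβ' j; omega⟩,
      fun j => ⟨(ζ j + K).toNat, by have := hζ' j; omega⟩⟩, ?_⟩
    intro t ht
    have e1 : (Q.corner i : ℕ) * K + (κ - (Q.corner i : ℕ) * K) = κ := by omega
    have e2 : (fun j => ((Q.corner j : ℕ) * K +
        (((β j - (Q.corner j : ℕ) * K).toNat : ℕ) : ℤ) : ℤ)) = β := by
      funext j
      rw [Int.toNat_of_nonneg (by have := hβ' j; omega)]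
      ring
    have e3 : (fun j => (((ζ j + K).toNat : ℕ) : ℤ) - (K : ℤ)) = ζ := by
      funext j
      rw [Int.toNat_of_nonneg (by have := hζ' j; omega)]
      ring
    simp only [e1, e2, e3]
    push Not
    exact hall t ht
  calc (percolationMeasure N d p).real {ω | ¬ IsGood ω m Q}
      ≤ (percolationMeasure N d p).real (⋃ a ∈ (Finset.univ : Finset I), E a) :=
        measureReal_mono hsub (measure_ne_top _ _)
    _ ≤ ∑ a : I, (percolationMeasure N d p).real (E a) := measureReal_biUnion_finset_le _ _
    _ ≤ ∑ _a : I, (1 - (1 - (p : ℝ)) ^ 13 ^ d) ^ r :=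
        Finset.sum_le_sum fun a _ => measure_path_le p _ _ _ _ _
    _ = _ := by
        rw [Finset.sum_const, nsmul_eq_mul, Finset.card_univ]
        simp [I]

/-- The probability that a cube is not `m`-good decays faster than any power of `N ^ (-m)`. -/
lemma exists_measure_not_isGood_le {N d : ℕ} {p : unitInterval} (hp : p < 1) (hN : 2 ≤ N)
    (hd : 2 ≤ d) (C : ℕ) : ∃ m : ℕ, 0 < m ∧ ∀ (n : ℕ) (Q : GridCube N d n),
      (percolationMeasure N d p).real {ω | ¬ IsGood ω m Q} ≤ ((N : ℝ) ^ (d * m + C))⁻¹ := by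
  obtain ⟨hρ0, hρ1⟩ := deletion_mem d hp
  set ρ := 1 - (1 - (p : ℝ)) ^ 13 ^ d with hρ
  have hNR : (0 : ℝ) < N := by exact_mod_cast (by omega : 0 < N)
  have hdR : (0 : ℝ) < d := by exact_mod_cast (by omega : 0 < d)
  -- There are at most `d (3K) ^ (2d + 1)` paths, and the target factor `N ^ (d m)` is just `K ^ d`;
  -- with `K ≤ 8 d r` everything becomes `D r ^ (3d + 1) ρ ^ r`.
  set D : ℝ := (N : ℝ) ^ C * d * 3 ^ (2 * d + 1) * (8 * d) ^ (3 * d + 1) with hD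
  have hlim := (tendsto_pow_const_mul_const_pow_of_abs_lt_one (3 * d + 1)
    (show |ρ| < 1 by rwa [abs_of_nonneg hρ0])).const_mul D
  rw [mul_zero] at hlim
  obtain ⟨R, hR⟩ := Filter.eventually_atTop.1 (hlim.eventually (gt_mem_nhds zero_lt_one))
  set m := 4 * d * (R + 8) with hm
  have hmK : m < N ^ m := Nat.lt_pow_self (by omega)
  set K := N ^ m with hK
  -- Dividing by `4 d` instead of `2 d` leaves room for the summand `8` as soon as `r ≥ 8`.
  set r := K / (4 * d) with hr
  have hr1 : 4 * d * r ≤ K := Nat.mul_div_le _ _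
  have hr2 : K < 4 * d * (r + 1) := Nat.lt_mul_div_succ _ (by omega)
  have hr3 : R + 8 ≤ r := (Nat.le_div_iff_mul_le (by omega)).2 (by rw [mul_comm]; omega)
  have hr4 : 2 * d * (r + 8) ≤ K := by nlinarith
  have hr5 : K ≤ 8 * d * r := by nlinarith
  refine ⟨m, by positivity, fun n Q => (measure_not_isGood_le p hN hr4 Q).trans ?_⟩
  rw [← hρ, ← hK, ← one_div, le_div_iff₀ (by positivity)]
  have hK1 : (1 : ℝ) ≤ K := by exact_mod_cast (Nat.one_le_pow _ _ (by omega) : 1 ≤ N ^ m)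
  have hKr : (K : ℝ) ≤ 8 * d * r := by exact_mod_cast hr5
  have hpow : (N : ℝ) ^ (d * m + C) = (K : ℝ) ^ d * (N : ℝ) ^ C := by
    rw [hK, pow_add, mul_comm d m, pow_mul]; push_cast; ring
  have hρr := pow_nonneg hρ0 r
  rw [hpow]
  push_cast
  calc (d : ℝ) * ((K + 1) * ((K + 1) ^ d * (2 * K + 1) ^ d)) * ρ ^ r * (K ^ d * N ^ C)
      ≤ d * ((3 * K) * ((3 * K) ^ d * (3 * K) ^ d)) * ρ ^ r * (K ^ d * N ^ C) := by
        gcongr <;> linarith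
    _ = (N : ℝ) ^ C * d * 3 ^ (2 * d + 1) * (K : ℝ) ^ (3 * d + 1) * ρ ^ r := by
        rw [mul_pow]; ring
    _ ≤ (N : ℝ) ^ C * d * 3 ^ (2 * d + 1) * (8 * d * r) ^ (3 * d + 1) * ρ ^ r := by gcongr
    _ = D * ((r : ℝ) ^ (3 * d + 1) * ρ ^ r) := by rw [mul_pow (8 * (d : ℝ))]; ring
    _ ≤ 1 := (hR r (by omega)).le

/-! ### Goodness along a sequence -/

/-- Strong deletion looks at neighbours that may lie outside `Q`; they still meet `Q`, which is why
dependence is measured by shadows rather than by subcubes. -/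
lemma IsGood.congr {N d n m : ℕ} {Q : GridCube N d n} {ω ω' : Config N d}
    (h : ∀ v ∈ shadow (n + m) Q, ω v = ω' v) (hω : IsGood ω m Q) : IsGood ω' m Q := by
  intro ℓ h1 h2 h3 i hi
  obtain ⟨Q', hQ', hdel, hrest⟩ := hω ℓ h1 h2 h3 i hi
  refine ⟨Q', hQ', fun R hR => ?_, hrest⟩
  rw [← h ⟨n + m, R⟩ ⟨rfl, hR.1.mono (Set.inter_subset_inter_right _ hQ')⟩]
  exact hdel R hR

lemma dependsOn_seqGood {N d : ℕ} (c m k : ℕ) : ∀ (L : ℕ → ℕ) (n : ℕ) (Q : GridCube N d n),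
    Antitone L → L k = 0 →
      DependsOn (fun ω => SeqGood ω c m k L n Q) (shadow (n + L 0 + m) Q) := by
  induction k with
  | zero =>
    intro L n Q _ h0 ω ω' h
    rw [h0] at h
    exact propext ⟨IsGood.congr h, IsGood.congr fun v hv => (h v hv).symm⟩
  | succ k ih =>
    intro L n Q hL _ ω ω' h
    have hlev : n + L k + (L 0 - L k) + m = n + L 0 + m := by
      have := hL (Nat.zero_le k); omega
    have hset : ∀ Q' : GridCube N d (n + L k), Q'.toSet ⊆ Q.toSet →
        SeqGood ω c m k (fun j => L j - L k) (n + L k) Q' =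
          SeqGood ω' c m k (fun j => L j - L k) (n + L k) Q' := by
      intro Q' hQ'
      refine ih (fun j => L j - L k) (n + L k) Q' (fun a b hab => Nat.sub_le_sub_right (hL hab) _)
        (Nat.sub_self _) fun v hv => h v ?_
      rw [hlev] at hv
      exact shadow_mono hQ' hv
    simp only [SeqGood]
    congr 2
    ext Q'
    exact and_congr_right fun hQ' => by rw [hset Q' hQ']

lemma measurableSet_not_seqGood {N d : ℕ} (c m k : ℕ) {L : ℕ → ℕ} {n : ℕ} (Q : GridCube N d n)
    (hL : Antitone L) (h0 : L k = 0) :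
    MeasurableSet[sigmaOn (shadow (n + L 0 + m) Q)] {ω | ¬ SeqGood ω c m k L n Q} :=
  measurableSet_sigmaOn (finite_shadow _ _) fun _ _ h =>
    congrArg Not (dependsOn_seqGood c m k L n Q hL h0 h)

lemma pow_mul_inv_pow_le {N : ℕ} (hN : 2 ≤ N) {a e e' : ℕ} (h : a + e' ≤ e) :
    (N : ℝ) ^ a * ((N : ℝ) ^ e)⁻¹ ≤ ((N : ℝ) ^ e')⁻¹ := by
  have hNR : (1 : ℝ) ≤ N := by exact_mod_cast (by omega : 1 ≤ N)
  have hN0 : (0 : ℝ) < N := by linarith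
  rw [← div_eq_mul_inv, div_le_iff₀ (by positivity), inv_mul_eq_div, le_div_iff₀ (by positivity),
    ← pow_add]
  exact pow_le_pow_right₀ hNR h

/-- Among more than `4 ^ d + 1` cubes of the same level there are five of the same parity. -/
lemma exists_five_same_parity {N d n : ℕ} (hd : 2 ≤ d) {B : Finset (GridCube N d n)}
    (hB : 4 ^ d + 1 < B.card) :
    ∃ T ⊆ B, T.card = 5 ∧ ∀ Q ∈ T, ∀ Q' ∈ T, Q.parity = Q'.parity := by
  classical
  -- There are `2 ^ d` parity classes, and `4 * 2 ^ d ≤ 4 ^ d` because `d ≥ 2`.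
  have h1 : (Finset.univ : Finset (Fin d → Fin 2)).card * 4 < B.card := by
    have h2 : 4 ≤ 2 ^ d := (by norm_num : 4 = 2 ^ 2) ▸ Nat.pow_le_pow_right two_pos hd
    have h3 : 4 ^ d = 2 ^ d * 2 ^ d := by rw [← mul_pow]; rfl
    have h4 : 2 ^ d * 4 ≤ 2 ^ d * 2 ^ d := Nat.mul_le_mul_left _ h2
    simp only [Finset.card_univ, Fintype.card_fun, Fintype.card_fin]
    omega
  obtain ⟨y, -, hy⟩ := Finset.exists_lt_card_fiber_of_mul_lt_card_of_maps_to
    (f := GridCube.parity) (fun _ _ => Finset.mem_univ _) h1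
  obtain ⟨T, hT, hT5⟩ := Finset.exists_subset_card_eq (show 5 ≤ _ from hy)
  refine ⟨T, fun Q hQ => (Finset.mem_filter.1 (hT hQ)).1, hT5, fun Q hQ Q' hQ' => ?_⟩
  rw [(Finset.mem_filter.1 (hT hQ)).2, (Finset.mem_filter.1 (hT hQ')).2]

/-- The exponent is chosen to survive the recursion. The fifth power turns it into `u 5 ^ (k + 1) +
100 d m₁ 4 ^ k`; the choice of five subcubes costs `5 d L k ≤ 20 d m₁ 4 ^ k`; what remains is at
least `u 5 ^ (k + 1) + 20 d m₁ 4 ^ (k + 1)`. -/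
lemma measure_not_seqGood_le {N d m u m₁ : ℕ} {p : unitInterval} (hN : 2 ≤ N) (hd : 2 ≤ d)
    (hm : 0 < m)
    (hgood : ∀ (n : ℕ) (Q : GridCube N d n), (percolationMeasure N d p).real {ω | ¬ IsGood ω m Q} ≤
      ((N : ℝ) ^ (u + 20 * d * m₁))⁻¹) (k : ℕ) :
    ∀ (L : ℕ → ℕ) (n : ℕ) (Q : GridCube N d n), Admissible m₁ L → L k = 0 →
      (percolationMeasure N d p).real {ω | ¬ SeqGood ω (4 ^ d + 1) m k L n Q} ≤
        ((N : ℝ) ^ (u * 5 ^ k + 20 * d * m₁ * 4 ^ k))⁻¹ := by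
  classical
  induction k with
  | zero =>
    intro L n Q _ _
    simpa [SeqGood] using hgood n Q
  | succ k ih =>
    intro L n Q hL h0
    set L' : ℕ → ℕ := fun j => L j - L k with hL'
    have hL'adm : Admissible m₁ L' :=
      ⟨fun j => Nat.sub_le_sub_right (hL.succ_le j) _, fun j => by
        have := hL.gap j; simp only [hL']; omega⟩
    have hL'k : L' k = 0 := Nat.sub_self _
    set ε : ℝ := ((N : ℝ) ^ (u * 5 ^ k + 20 * d * m₁ * 4 ^ k))⁻¹ with hε
    let E : GridCube N d (n + L k) → Set (Config N d) :=
      fun Q' => {ω | ¬ SeqGood ω (4 ^ d + 1) m k L' (n + L k) Q'}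
    set sub := Finset.univ.filter fun Q' : GridCube N d (n + L k) => Q'.toSet ⊆ Q.toSet with hsub
    set 𝒯 := (sub.powersetCard 5).filter fun T => ∀ Q ∈ T, ∀ Q' ∈ T, Q.parity = Q'.parity with h𝒯
    have hcover : {ω | ¬ SeqGood ω (4 ^ d + 1) m (k + 1) L n Q} ⊆ ⋃ T ∈ 𝒯, ⋂ Q' ∈ T, E Q' := by
      intro ω hω
      simp only [Set.mem_ofPred_eq, SeqGood, not_le] at hω
      rw [Set.ncard_eq_toFinset_card'] at hω
      obtain ⟨T, hT, hT5, hpar⟩ := exists_five_same_parity hd hω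
      have hT' : ∀ Q' ∈ T, Q'.toSet ⊆ Q.toSet ∧ ω ∈ E Q' := fun Q' hQ' => by
        simpa [E] using hT hQ'
      simp only [Set.mem_iUnion, Set.mem_iInter]
      refine ⟨T, ?_, fun Q' hQ' => (hT' Q' hQ').2⟩
      rw [h𝒯, Finset.mem_filter, Finset.mem_powersetCard]
      exact ⟨⟨fun Q' hQ' => by simpa [hsub] using (hT' Q' hQ').1, hT5⟩, hpar⟩
    have hT : ∀ T ∈ 𝒯, (percolationMeasure N d p).real (⋂ Q' ∈ T, E Q') ≤ ε ^ 5 := by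
      intro T hT
      rw [h𝒯, Finset.mem_filter, Finset.mem_powersetCard] at hT
      rw [measure_biInter_of_disjoint p T (fun Q' => shadow (n + L k + L' 0 + m) Q') E]
      · calc ∏ Q' ∈ T, (percolationMeasure N d p).real (E Q') ≤ ∏ _Q' ∈ T, ε :=
              Finset.prod_le_prod (fun _ _ => measureReal_nonneg)
                fun Q' _ => ih L' (n + L k) Q' hL'adm hL'k
          _ = ε ^ 5 := by rw [Finset.prod_const, hT.1.2]
      · intro Q₁ h₁ Q₂ h₂ hne
        exact disjoint_shadow hN (by omega) hne (hT.2 Q₁ h₁ Q₂ h₂)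
      · exact fun Q' _ => measurableSet_not_seqGood _ _ _ Q' hL'adm.antitone hL'k
    have hcard : (𝒯.card : ℝ) ≤ (N : ℝ) ^ (5 * (d * L k)) := by
      have h1 : 𝒯.card ≤ sub.card ^ 5 := by
        refine (Finset.card_filter_le _ _).trans ?_
        rw [Finset.card_powersetCard]
        exact Nat.choose_le_pow _ _
      have h2 : sub.card ^ 5 ≤ ((N ^ L k) ^ d) ^ 5 :=
        Nat.pow_le_pow_left (by convert card_subcubes_le hN Q) 5
      have h3 : ((N ^ L k) ^ d) ^ 5 = N ^ (5 * (d * L k)) := by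
        rw [← pow_mul, ← pow_mul]; congr 1; ring
      exact_mod_cast h1.trans (h2.trans h3.le)
    have hε0 : 0 ≤ ε := by positivity
    calc (percolationMeasure N d p).real {ω | ¬ SeqGood ω (4 ^ d + 1) m (k + 1) L n Q}
        ≤ (percolationMeasure N d p).real (⋃ T ∈ 𝒯, ⋂ Q' ∈ T, E Q') :=
          measureReal_mono hcover (measure_ne_top _ _)
      _ ≤ ∑ T ∈ 𝒯, (percolationMeasure N d p).real (⋂ Q' ∈ T, E Q') :=
          measureReal_biUnion_finset_le _ _
      _ ≤ ∑ _T ∈ 𝒯, ε ^ 5 := Finset.sum_le_sum hT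
      _ = 𝒯.card * ε ^ 5 := by rw [Finset.sum_const, nsmul_eq_mul]
      _ ≤ (N : ℝ) ^ (5 * (d * L k)) *
            ((N : ℝ) ^ ((u * 5 ^ k + 20 * d * m₁ * 4 ^ k) * 5))⁻¹ := by
          rw [hε, inv_pow, ← pow_mul]
          gcongr
      _ ≤ _ := by
          refine pow_mul_inv_pow_le hN ?_
          have h1 : L k ≤ m₁ * 4 ^ (k + 1) := by have := hL.gap k; omega
          have h2 := Nat.mul_le_mul_left (5 * d) h1
          rw [pow_succ] at *
          rw [pow_succ]
          linarith

/-! ### Chains of bad cubes -/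

/-- Some cube in `K_Q` is bad with respect to the sequence `L`. -/
def BadNear {N d n : ℕ} (ω : Config N d) (c m : ℕ) (L : ℕ → ℕ) (Q : GridCube N d n) : Prop :=
  ∃ Q' : GridCube N d n, Q'.toSet ⊆ Q.bigNbhd ∧ ¬ SeqGood ω c m (lastIndex L) L n Q'

/-- There is a chain of length `j` of cubes, beginning with `Q`, which are near a bad cube with
respect to one of the sequences `𝓛 0, …, 𝓛 q`; the level of the next cube is just beyond the
levels that the badness depends on. -/
def BadChain {N d : ℕ} (ω : Config N d) (c m q : ℕ) (𝓛 : ℕ → ℕ → ℕ) :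
    (j n : ℕ) → GridCube N d n → Prop
  | 0, _, _ => True
  | j + 1, n, Q => ∃ l < q + 1, BadNear ω c m (𝓛 l) Q ∧
      ∃ Q' : GridCube N d (n + (𝓛 l 0 + m + 1)), Q'.toSet ⊆ Q.toSet ∧
        BadChain ω c m q 𝓛 j (n + (𝓛 l 0 + m + 1)) Q'

lemma setOf_badNear {N d n : ℕ} (c m : ℕ) (L : ℕ → ℕ) (Q : GridCube N d n) :
    {ω : Config N d | BadNear ω c m L Q} =
      ⋃ Q' ∈ {Q' : GridCube N d n | Q'.toSet ⊆ Q.bigNbhd},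
        {ω | ¬ SeqGood ω c m (lastIndex L) L n Q'} := by
  ext ω
  simp [BadNear]

lemma measurableSet_badNear {N d n : ℕ} (c m : ℕ) {L : ℕ → ℕ} (hL : Antitone L)
    (h0 : L (lastIndex L) = 0) (Q : GridCube N d n) :
    MeasurableSet[sigmaOn {v : Vertex N d | v.1 = n + L 0 + m}] {ω | BadNear ω c m L Q} := by
  rw [setOf_badNear]
  exact MeasurableSet.biUnion (Set.to_countable _) fun Q' _ =>
    sigmaOn_mono (fun v hv => hv.1) _ (measurableSet_not_seqGood c m _ Q' hL h0)

lemma setOf_badChain_succ {N d : ℕ} (c m q : ℕ) (𝓛 : ℕ → ℕ → ℕ) (j n : ℕ) (Q : GridCube N d n) :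
    {ω : Config N d | BadChain ω c m q 𝓛 (j + 1) n Q} =
      ⋃ l ∈ Finset.range (q + 1),
        ⋃ Q' ∈ {Q' : GridCube N d (n + (𝓛 l 0 + m + 1)) | Q'.toSet ⊆ Q.toSet}.toFinite.toFinset,
          {ω | BadNear ω c m (𝓛 l) Q} ∩ {ω | BadChain ω c m q 𝓛 j _ Q'} := by
  ext ω
  simp only [BadChain, Set.mem_ofPred_eq, Set.mem_iUnion, Finset.mem_range,
    Set.Finite.mem_toFinset, Set.mem_inter_iff, exists_prop]
  constructor
  · rintro ⟨l, hl, hb, Q', hQ', hc⟩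
    exact ⟨l, hl, Q', hQ', hb, hc⟩
  · rintro ⟨l, hl, Q', hQ', hb, hc⟩
    exact ⟨l, hl, hb, Q', hQ', hc⟩

lemma measurableSet_badChain {N d : ℕ} (c m q : ℕ) {𝓛 : ℕ → ℕ → ℕ} (hL : ∀ l, Antitone (𝓛 l))
    (h0 : ∀ l, 𝓛 l (lastIndex (𝓛 l)) = 0) (hm : 0 < m) (j : ℕ) : ∀ (n : ℕ) (Q : GridCube N d n),
      MeasurableSet[sigmaOn {v : Vertex N d | n < v.1}] {ω | BadChain ω c m q 𝓛 j n Q} := by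
  induction j with
  | zero => intro n Q; simp [BadChain]
  | succ j ih =>
    intro n Q
    rw [setOf_badChain_succ]
    refine MeasurableSet.biUnion (Set.to_countable _) fun l _ =>
      MeasurableSet.biUnion (Set.to_countable _) fun Q' _ => MeasurableSet.inter ?_ ?_
    · refine sigmaOn_mono (fun v hv => ?_) _ (measurableSet_badNear c m (hL l) (h0 l) Q)
      simp only [Set.mem_ofPred_eq] at hv ⊢
      omega
    · refine sigmaOn_mono (fun v hv => ?_) _ (ih _ Q')
      simp only [Set.mem_ofPred_eq] at hv ⊢
      omega

/-- The first link and the rest of the chain depend on disjoint sets of levels. The number of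
possible next cubes is included in `hbad`, so each link costs at most the sum of `2 ^ (-(l + 2))`,
which is at most `1/2` for every `q`. -/
lemma measure_badChain_le {N d : ℕ} (p : unitInterval) (hN : 2 ≤ N) (c m q : ℕ)
    {𝓛 : ℕ → ℕ → ℕ} (hL : ∀ l, Antitone (𝓛 l)) (h0 : ∀ l, 𝓛 l (lastIndex (𝓛 l)) = 0) (hm : 0 < m)
    (hbad : ∀ (l n : ℕ) (Q : GridCube N d n),
      (N : ℝ) ^ (d * (𝓛 l 0 + m + 1)) *
        (percolationMeasure N d p).real {ω | BadNear ω c m (𝓛 l) Q} ≤ (1 / 2) ^ (l + 2))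
    (j : ℕ) : ∀ (n : ℕ) (Q : GridCube N d n),
      (percolationMeasure N d p).real {ω | BadChain ω c m q 𝓛 j n Q} ≤ (1 / 2) ^ j := by
  classical
  set μ := percolationMeasure N d p with hμ
  induction j with
  | zero => intro n Q; simp [BadChain]
  | succ j ih =>
    intro n Q
    rw [setOf_badChain_succ]
    have hterm : ∀ l, ∀ Q' : GridCube N d (n + (𝓛 l 0 + m + 1)),
        μ.real ({ω | BadNear ω c m (𝓛 l) Q} ∩ {ω | BadChain ω c m q 𝓛 j _ Q'}) ≤
          μ.real {ω | BadNear ω c m (𝓛 l) Q} * (1 / 2) ^ j := by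
      intro l Q'
      rw [hμ, measure_inter_of_disjoint p _ (measurableSet_badNear c m (hL l) (h0 l) Q)
        (measurableSet_badChain c m q hL h0 hm j _ Q'), ← hμ]
      · exact mul_le_mul_of_nonneg_left (ih _ Q') measureReal_nonneg
      · rw [Set.disjoint_left]
        intro v hv hv'
        simp only [Set.mem_ofPred_eq] at hv hv'
        omega
    have hcard : ∀ l, (({Q' : GridCube N d (n + (𝓛 l 0 + m + 1)) |
        Q'.toSet ⊆ Q.toSet}.toFinite.toFinset.card : ℕ) : ℝ) ≤
          (N : ℝ) ^ (d * (𝓛 l 0 + m + 1)) := by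
      intro l
      have h1 := card_subcubes_le (m := 𝓛 l 0 + m + 1) hN Q
      rw [← pow_mul, mul_comm _ d] at h1
      have h2 : {Q' : GridCube N d (n + (𝓛 l 0 + m + 1)) | Q'.toSet ⊆ Q.toSet}.toFinite.toFinset =
          Finset.univ.filter fun Q' => Q'.toSet ⊆ Q.toSet := by ext; simp
      rw [h2]
      exact_mod_cast h1
    have hgeom : ∀ q : ℕ, ∑ l ∈ Finset.range q, (1 / 2 : ℝ) ^ (l + 2) ≤ 1 / 2 := by
      intro q
      have : ∀ q : ℕ, ∑ l ∈ Finset.range q, (1 / 2 : ℝ) ^ (l + 2) = 1 / 2 - (1 / 2) ^ (q + 1) := by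
        intro q
        induction q with
        | zero => norm_num
        | succ q ih => rw [Finset.sum_range_succ, ih]; ring
      rw [this]
      have : (0 : ℝ) < (1 / 2) ^ (q + 1) := by positivity
      linarith
    calc _ ≤ ∑ l ∈ Finset.range (q + 1), μ.real (⋃ Q' ∈ {Q' : GridCube N d (n + (𝓛 l 0 + m + 1)) |
            Q'.toSet ⊆ Q.toSet}.toFinite.toFinset,
          {ω | BadNear ω c m (𝓛 l) Q} ∩ {ω | BadChain ω c m q 𝓛 j _ Q'}) :=
          measureReal_biUnion_finset_le _ _
      _ ≤ ∑ l ∈ Finset.range (q + 1), (1 / 2 : ℝ) ^ (l + 2) * (1 / 2) ^ j := by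
          refine Finset.sum_le_sum fun l _ => ?_
          refine (measureReal_biUnion_finset_le _ _).trans
            ((Finset.sum_le_sum fun Q' _ => hterm l Q').trans ?_)
          rw [Finset.sum_const, nsmul_eq_mul, ← mul_assoc]
          refine mul_le_mul_of_nonneg_right ((mul_le_mul_of_nonneg_right (hcard l)
            measureReal_nonneg).trans (hbad l n Q)) (by positivity)
      _ ≤ 1 / 2 * (1 / 2) ^ j := by
          rw [← Finset.sum_mul]
          exact mul_le_mul_of_nonneg_right (hgeom _) (by positivity)
      _ = (1 / 2) ^ (j + 1) := by ring

lemma measure_badNear_le {N d n : ℕ} (p : unitInterval) (hN : 2 ≤ N) (c m : ℕ) (L : ℕ → ℕ) {ε : ℝ}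
    (h : ∀ Q' : GridCube N d n, (percolationMeasure N d p).real
      {ω | ¬ SeqGood ω c m (lastIndex L) L n Q'} ≤ ε) (hε : 0 ≤ ε) (Q : GridCube N d n) :
    (percolationMeasure N d p).real {ω | BadNear ω c m L Q} ≤ 5 ^ d * ε := by
  classical
  have h1 : {ω : Config N d | BadNear ω c m L Q} =
      ⋃ Q' ∈ Finset.univ.filter fun Q' : GridCube N d n => Q'.toSet ⊆ Q.bigNbhd,
        {ω | ¬ SeqGood ω c m (lastIndex L) L n Q'} := by
    ext ω
    simp [BadNear]
  rw [h1]
  refine (measureReal_biUnion_finset_le _ _).trans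
    ((Finset.sum_le_sum fun Q' _ => h Q').trans ?_)
  rw [Finset.sum_const, nsmul_eq_mul]
  refine mul_le_mul_of_nonneg_right ?_ hε
  have h2 := card_subset_bigNbhd_le hN Q
  exact_mod_cast (by convert h2 :
    (Finset.univ.filter fun Q' : GridCube N d n => Q'.toSet ⊆ Q.bigNbhd).card ≤ 5 ^ d)

/-- Every level from `n₀` on is bad near `x`, so wherever a link ends, the cube around `x` at that
level begins the next link. -/
lemma badChain_of_mem_exceptionalSet {N d : ℕ} (hN : 2 ≤ N) {ω : Config N d} {q m₁ k₀ c m n₀ : ℕ}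
    {x : Space d} (hx : ∀ i, x i ∈ Set.Icc (0 : ℝ) 1)
    (hn : ∀ n ≥ n₀, ¬ ∃ Q : GridCube N d n, IsCubeOf x Q ∧
      ∀ Q' : GridCube N d n, Q'.toSet ⊆ Q.bigNbhd → HereditarilyGood ω q m₁ k₀ c m Q')
    (j : ℕ) : ∀ n ≥ n₀, ∀ Q : GridCube N d n, IsCubeOf x Q →
      BadChain ω c m q (levelSeq m₁ k₀) j n Q := by
  induction j with
  | zero => exact fun _ _ _ _ => trivial
  | succ j ih =>
    intro n hn' Q hQ
    have h1 := hn n hn'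
    push Not at h1
    obtain ⟨Q', hQ', hbad⟩ := h1 Q hQ
    simp only [HereditarilyGood] at hbad
    push Not at hbad
    obtain ⟨l, hl, hbad⟩ := hbad
    obtain ⟨Q'', hQ''⟩ := exists_isCubeOf hN (n + (levelSeq m₁ k₀ l 0 + m + 1)) hx
    exact ⟨l, by omega, ⟨Q', hQ', hbad⟩, Q'', hQ.subset hN hQ'', ih _ (by omega) Q'' hQ''⟩

/-- For large `m₀`, almost surely every point of the unit cube lies, for infinitely many `n`, in a
cube of level `n` all whose near cubes are hereditarily good. -/
theorem exists_ae_exceptionalSet_eq_empty {d N : ℕ} (hd : 2 ≤ d) (hN : 2 ≤ N) {p : unitInterval}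
    (hp : p < 1) {m₁ : ℕ} (hm₁ : 1 ≤ m₁) :
    ∃ m₀ : ℕ, 0 < m₀ ∧ ∀ k₀ : ℕ, 2 ≤ k₀ → ∀ᵐ ω ∂(percolationMeasure N d p), ∀ q : ℕ,
      exceptionalSet ω q m₁ k₀ (4 ^ d + 1) m₀ = ∅ := by
  obtain ⟨m, hm, hgood⟩ := exists_measure_not_isGood_le hp hN hd (4 * d + 1 + 20 * d * m₁)
  refine ⟨m, hm, fun k₀ hk₀ => ?_⟩
  -- The summands pay for the `m + 1` extra levels below depth `L 0`, for the `5 ^ d ≤ N ^ (3 d)`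
  -- near cubes, and for `l + 2 ≤ L 0 + 1`. The depth `L 0` itself is paid for by the term with `4 ^
  -- k`.
  set u := d * (m + 1) + 3 * d + 1 with hu
  have hgood' : ∀ (n : ℕ) (Q : GridCube N d n),
      (percolationMeasure N d p).real {ω | ¬ IsGood ω m Q} ≤ ((N : ℝ) ^ (u + 20 * d * m₁))⁻¹ := by
    intro n Q
    have h := hgood n Q
    rwa [show d * m + (4 * d + 1 + 20 * d * m₁) = u + 20 * d * m₁ by rw [hu]; ring] at h
  have hadm := fun l => levelSeq_admissible hm₁ hk₀ l
  have hlast := fun l => levelSeq_lastIndex hm₁ hk₀ l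
  have hbad : ∀ (l n : ℕ) (Q : GridCube N d n),
      (N : ℝ) ^ (d * (levelSeq m₁ k₀ l 0 + m + 1)) * (percolationMeasure N d p).real
        {ω | BadNear ω (4 ^ d + 1) m (levelSeq m₁ k₀ l) Q} ≤ (1 / 2) ^ (l + 2) := by
    intro l n Q
    set L := levelSeq m₁ k₀ l with hL
    set k := lastIndex L with hk
    have hN2 : (2 : ℝ) ≤ N := by exact_mod_cast hN
    have h1 := measure_badNear_le p hN (4 ^ d + 1) m L (fun Q' : GridCube N d n =>
      measure_not_seqGood_le hN hd hm hgood' k L n Q' (hadm l) (hlast l)) (by positivity) Q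
    have h5 : (5 : ℝ) ^ d ≤ (N : ℝ) ^ (3 * d) := by
      rw [pow_mul]
      refine pow_le_pow_left₀ (by norm_num) ?_ d
      calc (5 : ℝ) ≤ 2 ^ 3 := by norm_num
        _ ≤ (N : ℝ) ^ 3 := by gcongr
    calc _ ≤ (N : ℝ) ^ (d * (L 0 + m + 1)) * ((N : ℝ) ^ (3 * d) *
          ((N : ℝ) ^ (u * 5 ^ k + 20 * d * m₁ * 4 ^ k))⁻¹) := by
          refine mul_le_mul_of_nonneg_left (h1.trans ?_) (by positivity)
          gcongr
      _ = (N : ℝ) ^ (d * (L 0 + m + 1) + 3 * d) *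
          ((N : ℝ) ^ (u * 5 ^ k + 20 * d * m₁ * 4 ^ k))⁻¹ := by rw [pow_add]; ring
      _ ≤ ((N : ℝ) ^ (l + 2))⁻¹ := by
          refine pow_mul_inv_pow_le hN ?_
          have e1 : l < L 0 := lt_levelSeq_zero hm₁ hk₀ l
          have e2 : L 0 ≤ 2 * m₁ * 4 ^ k := by
            have := (hadm l).zero_le k
            have h0 : L k = 0 := hlast l
            rw [← hL, h0] at this
            omega
          have e3 : u ≤ u * 5 ^ k := Nat.le_mul_of_pos_right _ (by positivity)
          have e4 := Nat.mul_le_mul_left (2 * d) e2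
          have e5 : L 0 ≤ d * L 0 := Nat.le_mul_of_pos_left _ (by omega)
          have e6 : 0 ≤ d * m₁ * 4 ^ k := Nat.zero_le _
          have e7 : l + 2 ≤ L 0 + 1 := by omega
          calc _ ≤ u + 2 * d * L 0 := by rw [hu]; linarith
            _ ≤ u * 5 ^ k + 20 * d * m₁ * 4 ^ k := by linarith
      _ ≤ (1 / 2) ^ (l + 2) := by
          rw [one_div, inv_pow]
          gcongr
  have hae : ∀ (q n : ℕ) (Q : GridCube N d n), ∀ᵐ ω ∂(percolationMeasure N d p),
      ¬ ∀ j, BadChain ω (4 ^ d + 1) m q (levelSeq m₁ k₀) j n Q := by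
    intro q n Q
    rw [ae_iff]
    simp only [not_not]
    rw [← measureReal_eq_zero_iff]
    refine le_antisymm (ge_of_tendsto' (tendsto_pow_atTop_nhds_zero_of_lt_one (r := (1 / 2 : ℝ))
      (by norm_num) (by norm_num)) fun j => ?_) measureReal_nonneg
    have hsub : {ω : Config N d | ∀ j, BadChain ω (4 ^ d + 1) m q (levelSeq m₁ k₀) j n Q} ⊆
      {ω | BadChain ω (4 ^ d + 1) m q (levelSeq m₁ k₀) j n Q} := fun ω hω => by
        simp only [Set.mem_ofPred_eq] at hω ⊢
        exact hω j
    exact (measureReal_mono hsub (measure_ne_top _ _)).trans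
      (measure_badChain_le p hN _ m q (fun l => (hadm l).antitone) hlast hm hbad j n Q)
  filter_upwards [ae_all_iff.2 fun q => ae_all_iff.2 fun n => ae_all_iff.2 (hae q n)] with ω hω q
  rw [Set.eq_empty_iff_forall_notMem]
  rintro x ⟨hx, hfin⟩
  obtain ⟨n₀, hn₀⟩ := hfin.bddAbove
  obtain ⟨Q, hQ⟩ := exists_isCubeOf hN (n₀ + 1) hx
  exact hω q (n₀ + 1) Q fun j => badChain_of_mem_exceptionalSet hN hx
    (fun n hn h => by have := hn₀ h; omega) j (n₀ + 1) le_rfl Q hQ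

end

end FractalPercolation

theorem proposition5p10 (d N : ℕ) (hd : 2 ≤ d) (hN : 2 ≤ N) (p : unitInterval) (hp : p < 1)
    (m₁ : ℕ) (hm₁ : 1 ≤ m₁) :
    ∃ m₀ : ℕ, 0 < m₀ ∧ ∀ k₀ : ℕ, 2 ≤ k₀ →
      ∀ᵐ ω ∂(FractalPercolation.percolationMeasure N d p), ∀ q : ℕ,
        dimH (FractalPercolation.exceptionalSet ω q m₁ k₀ (4 ^ d + 1) m₀) < 1 := by
  obtain ⟨m₀, hm₀, h⟩ := FractalPercolation.exists_ae_exceptionalSet_eq_empty hd hN hp hm₁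
  refine ⟨m₀, hm₀, fun k₀ hk₀ => ?_⟩
  filter_upwards [h k₀ hk₀] with ω hω q
  rw [hω q, dimH_empty]
  exact one_pos
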